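/- Let $\mathbb F$ be a field of characteristic $0$, $n\ge 1$ an integer, and $\Gamma$ a nonzero torsion-free abelian group. For $1\le p\le 2n$ let $\mathcal J_p\in\{\{0\},\mathbb N\}$ (where $0\in\mathbb N$), and put $\boldsymbol{\mathcal J}=\mathcal J_1\times\cdots\times\mathcal J_{2n}$. Let $\phi:\Gamma\times\Gamma\to\mathbb F$ be a skew-symmetric $\mathbb Z$-bilinear form with radical $\mathrm{Rad}_\phi=\{\alpha\in\Gamma : \phi(\alpha,\beta)=0 \text{ for all }\beta\in\Gamma\}$, and let $\varphi_1,\dots,\varphi_{2n}:\Gamma\to\mathbb F$ be additive group homomorphisms such that (i) for every $p$, $\varphi_p\not\equiv 0$ or $\mathcal J_p\ne\{0\}$; (ii) $\mathrm{Rad}_\phi\cap\bigcap_{p=1}^{2n}\ker\varphi_p=\{0\}$; (iii) for every $q$ with $\varphi_q\not\equiv0$ there is $\tau\in\mathrm{Rad}_\phi\cap\bigcap_{p\ne q}\ker\varphi_p$ with $\varphi_q(\tau)\neq0$. For $1\le s\le n-1$ fix $\sigma_{2s+1}=\sigma_{2s+2}\in\mathrm{Rad}_\phi\cap\bigcap_{p\ne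 2s+1,2s+2}\ker\varphi_p$, with $\sigma_{2s+1}\ne0$ whenever $\varphi_{2s+1}\not\equiv0$ or $\varphi_{2s+2}\not\equiv0$. Let $\varepsilon\in\mathrm{Rad}_\phi\cap\bigcap_{p=2}^{2n}\ker\varphi_p$ with $\varphi_1(\varepsilon)=1$. Let $\mathscr A$ be the commutative associative $\mathbb F$-algebra with basis $\{x^{\alpha,\mathbf i} : \alpha\in\Gamma,\ \mathbf i\in\boldsymbol{\mathcal J}\}$ and product $x^{\alpha,\mathbf i}x^{\beta,\mathbf j}=x^{\alpha+\beta,\mathbf i+\mathbf j}$. Let $\partial_p$ be the linear map with $\partial_p(x^{\alpha,\mathbf i})=\varphi_p(\alpha)x^{\alpha,\mathbf i}+i_p\,x^{\alpha,\mathbf i-1_{[p]}}$, where $1_{[p]}$ is the $p$-th unit vector and the second term is $0$ if $i_p=0$. Equip $\mathscr A$ with the Lie bracket that is bilinear and satisfies $$[u,w]=x^{\varepsilon,\mathbf 0}\Big(\sum_{s=1}^{n-1}x^{\sigma_{2s+1},\mathbf 0}\big(\partial_{2s+1}(u)\partial_{2s+2}(w)-\partial_{2s+1}(w)\partial_{2s+2}(u)\big)+\phi(\alpha,\beta)uw\Big)+(\partial_1+1)(u)\,\partial_2(w)-(\partial_1+1)(w)\,\partial_2(u)$$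 for $u\in\mathrm{span}\{x^{\alpha,\mathbf i}:\mathbf i\in\boldsymbol{\mathcal J}\}$ and $w\in\mathrm{span}\{x^{\beta,\mathbf j}:\mathbf j\in\boldsymbol{\mathcal J}\}$. The element $x^{-\varepsilon,\mathbf 0}$ is central; let $\mathscr H=\mathscr A/\mathbb F x^{-\varepsilon,\mathbf 0}$ be the quotient Lie algebra (the twisted Hamiltonian Lie algebra), and put $\sigma=\sum_{s=1}^{n-1}\sigma_{2s+1}-2\varepsilon$. **Theorem.** If $\boldsymbol{\mathcal J}\ne\{\mathbf 0\}$, then the Lie algebra $\mathscr H$ is simple. If $\boldsymbol{\mathcal J}=\{\mathbf 0\}$, then the derived algebra $\mathscr H^{(1)}=[\mathscr H,\mathscr H]$ is a simple Lie algebra, and, as vector spaces, $\mathscr H=\mathscr H^{(1)}\oplus\big(\mathbb F x^{\sigma,\mathbf 0}+\mathbb F x^{-\varepsilon,\mathbf 0}\big)/\mathbb F x^{-\varepsilon,\mathbf 0}$. -/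

import Mathlib

/-- The initial data of a twisted Hamiltonian Lie algebra over `F`, with `n = m + 1` pairs of
derivations.

The `2n` indices `p` are written as pairs `(s, 0) = 2s+1` and `(s, 1) = 2s+2` with `0 ≤ s ≤ n-1`,
so `(0, 0)` is the first and `(0, 1)` the second index.  The elements `σ_{2s+1} = σ_{2s+2}` with
`1 ≤ s ≤ n-1` are `σ t` with `s = t.succ`.  As the form `φ` is skew-symmetric, its radical is the
kernel of `form : Γ →+ (Γ →+ F)`. -/
structure TwistedHamiltonianData (F Γ : Type*) [Field F] [AddCommGroup Γ] (m : ℕ) where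
  /-- the semigroups `𝒥_p`, each of them `{0}` or `ℕ` -/
  J : Fin (m + 1) × Fin 2 → AddSubmonoid ℕ
  J_eq : ∀ p, J p = ⊥ ∨ J p = ⊤
  /-- the skew-symmetric `ℤ`-bilinear form `φ(·,·)` -/
  form : Γ →+ Γ →+ F
  form_skew : ∀ α β, form α β = -form β α
  /-- the additive homomorphisms `φ_p` -/
  weight : Fin (m + 1) × Fin 2 → (Γ →+ F)
  weight_or_J : ∀ p, weight p ≠ 0 ∨ J p ≠ ⊥
  radical_inf_ker : form.ker ⊓ (⨅ p, (weight p).ker) = ⊥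
  exists_separating : ∀ q, weight q ≠ 0 →
    ∃ τ ∈ form.ker, (∀ p, p ≠ q → weight p τ = 0) ∧ weight q τ ≠ 0
  /-- the elements `σ_{2s+1} = σ_{2s+2}` -/
  σ : Fin m → Γ
  σ_mem : ∀ t, σ t ∈ form.ker
  weight_σ : ∀ t p, p.1 ≠ t.succ → weight p (σ t) = 0
  σ_ne_zero : ∀ t, weight (t.succ, 0) ≠ 0 ∨ weight (t.succ, 1) ≠ 0 → σ t ≠ 0
  /-- the element `ε` -/
  ε : Γ
  ε_mem : ε ∈ form.ker
  weight_ε : ∀ p, p ≠ (0, 0) → weight p ε = 0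
  weight_zero_ε : weight (0, 0) ε = 1

namespace TwistedHamiltonianData

section Jacobi

variable {F R : Type*} [Field F] [CommRing R] [Algebra F R]

/-- A piece `f ((d + c) u · e w - (d + c) w · e u)` of the bracket. -/
def piece (f c : R) (d e : Derivation F R R) (u w : R) : R :=
  f * ((d u + c * u) * e w - (d w + c * w) * e u)

theorem piece_cross (f c g c' : R) (d e d' e' : Derivation F R R)
    (h2 : ∀ u, d (d' u) = d' (d u)) (h3 : ∀ u, d (e' u) = e' (d u))
    (h4 : ∀ u, e (d' u) = d' (e u)) (h5 : ∀ u, e (e' u) = e' (e u))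
    (hdc : d c' = 0) (hec : e c' = 0) (hdc' : d' c = 0) (hec' : e' c = 0)
    (hg : d g = c * g) (hg' : e g = 0) (hf : d' f = c' * f) (hf' : e' f = 0) (u v w : R) :
    (piece f c d e u (piece g c' d' e' v w) + piece f c d e v (piece g c' d' e' w u)
      + piece f c d e w (piece g c' d' e' u v))
    + (piece g c' d' e' u (piece f c d e v w) + piece g c' d' e' v (piece f c d e w u)
      + piece g c' d' e' w (piece f c d e u v)) = 0 := by
  simp only [piece, Derivation.leibniz, map_add, map_sub, smul_eq_mul, hdc, hec, hdc', hec', hg,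
    hg', hf, hf', h2, h3, h4, h5]
  ring

theorem piece_self (f c : R) (d e : Derivation F R R)
    (h1 : ∀ u, d (e u) = e (d u)) (hdc : d c = 0) (hec : e c = 0) (u v w : R) :
    piece f c d e u (piece f c d e v w) + piece f c d e v (piece f c d e w u)
      + piece f c d e w (piece f c d e u v) = 0 := by
  simp only [piece, Derivation.leibniz, map_add, map_sub, smul_eq_mul, hdc, hec, h1]
  ring

theorem piece_form (f c ε : R) (d e : Derivation F R R) (P : R →ₗ[F] R →ₗ[F] R)
    (hskew : ∀ u v, P u v = -P v u) (hmul : ∀ u v w, P u (v * w) = v * P u w + w * P u v)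
    (hd : ∀ u v, d (P u v) = P (d u) v + P u (d v))
    (he : ∀ u v, e (P u v) = P (e u) v + P u (e v))
    (hPf : ∀ u, P u f = 0) (hPc : ∀ u, P u c = 0)
    (hdε : d ε = c * ε) (heε : e ε = 0) (u v w : R) :
    (piece f c d e u (ε * P v w) + piece f c d e v (ε * P w u) + piece f c d e w (ε * P u v))
    + (ε * P u (piece f c d e v w) + ε * P v (piece f c d e w u) + ε * P w (piece f c d e u v))
      = 0 := by
  simp only [piece, Derivation.leibniz, map_add, map_sub, smul_eq_mul, hmul, hd, he, hPf, hPc,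
    hdε, heε]
  rw [hskew (d v) w, hskew (e v) w, hskew (d w) u, hskew (e w) u, hskew (d u) v, hskew (e u) v,
    hskew u w, hskew v u, hskew w v]
  ring

theorem piece_sum_right {ι : Type*} (s : Finset ι) (f c : R) (d e : Derivation F R R)
    (u : R) (g : ι → R) : piece f c d e u (∑ i ∈ s, g i) = ∑ i ∈ s, piece f c d e u (g i) := by
  simp only [piece, map_sum, Finset.mul_sum, Finset.sum_mul, Finset.sum_sub_distrib, mul_sub,
    add_mul, mul_add, Finset.sum_add_distrib]

theorem piece_add_right (f c : R) (d e : Derivation F R R) (u v w : R) :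
    piece f c d e u (v + w) = piece f c d e u v + piece f c d e u w := by
  simp only [piece, map_add]
  ring

end Jacobi

noncomputable section

variable {F Γ : Type*} [Field F] [AddCommGroup Γ] {m : ℕ} (D : TwistedHamiltonianData F Γ m)

/-- The product semigroup `𝒥 = 𝒥_1 × ⋯ × 𝒥_{2n}`. -/
def multiIdx : AddSubmonoid (Fin (m + 1) × Fin 2 → ℕ) := AddSubmonoid.pi Set.univ D.J

/-- The commutative associative algebra `𝒜` with basis `x^{α,i}`, `(α, i) ∈ Γ × 𝒥`, and
`x^{α,i} x^{β,j} = x^{α+β,i+j}`. -/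
abbrev Alg : Type _ := AddMonoidAlgebra F (Γ × D.multiIdx)

/-- The basis element `x^{α,i}`. -/
def x (α : Γ) (i : D.multiIdx) : D.Alg := AddMonoidAlgebra.single (α, i) 1

/-- The basis `x^{α,i}` of `𝒜`. -/
def xBasis : Module.Basis (Γ × D.multiIdx) F D.Alg := AddMonoidAlgebra.basis _ _

/-- The multi-index `i - 1_{[p]}` if `i_p ≠ 0`, and `i` if `i_p = 0`. -/
def lower (p : Fin (m + 1) × Fin 2) (i : D.multiIdx) : D.multiIdx :=
  ⟨Function.update i.1 p (i.1 p - 1), by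
    have hi := i.2
    simp only [multiIdx, AddSubmonoid.mem_pi, Set.mem_univ, true_implies] at hi ⊢
    intro q
    by_cases h : q = p
    · subst h
      rcases D.J_eq q with h | h
      · have := hi q
        rw [h, AddSubmonoid.mem_bot] at this
        simp [h, this]
      · simp [h]
    · simpa [Function.update_of_ne h] using hi q⟩

/-- `∂_p(x^{α,i}) = φ_p(α) x^{α,i} + i_p x^{α,i-1_{[p]}}`. -/
def del (p : Fin (m + 1) × Fin 2) : D.Alg →ₗ[F] D.Alg :=
  D.xBasis.constr F fun a =>
    D.weight p a.1 • D.x a.1 a.2 + (a.2.1 p : F) • D.x a.1 (D.lower p a.2)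

/-- The bilinear map with `(u, w) ↦ φ(α, β) u w` for `u ∈ 𝒜_α`, `w ∈ 𝒜_β`. -/
def formMul : D.Alg →ₗ[F] D.Alg →ₗ[F] D.Alg :=
  D.xBasis.constr F fun a => D.xBasis.constr F fun b =>
    D.form a.1 b.1 • (D.x a.1 a.2 * D.x b.1 b.2)

/-- The bracket of the twisted Hamiltonian Lie algebra on `𝒜`. -/
def br (u w : D.Alg) : D.Alg :=
  D.x D.ε 0 * ((∑ t : Fin m, D.x (D.σ t) 0 *
      (D.del (t.succ, 0) u * D.del (t.succ, 1) w - D.del (t.succ, 0) w * D.del (t.succ, 1) u))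
    + D.formMul u w)
  + (D.del (0, 0) u + u) * D.del (0, 1) w - (D.del (0, 0) w + w) * D.del (0, 1) u

theorem xBasis_apply (a : Γ × D.multiIdx) : D.xBasis a = D.x a.1 a.2 := by
  simp [xBasis, x]

theorem x_mul_x (α β : Γ) (i j : D.multiIdx) : D.x α i * D.x β j = D.x (α + β) (i + j) := by
  simp [x, AddMonoidAlgebra.single_mul_single]

theorem del_x (p : Fin (m + 1) × Fin 2) (α : Γ) (i : D.multiIdx) :
    D.del p (D.x α i) = D.weight p α • D.x α i + (i.1 p : F) • D.x α (D.lower p i) := by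
  have := D.xBasis.constr_basis F (fun a : Γ × D.multiIdx =>
    D.weight p a.1 • D.x a.1 a.2 + (a.2.1 p : F) • D.x a.1 (D.lower p a.2)) (α, i)
  rwa [xBasis_apply] at this

theorem formMul_x (α β : Γ) (i j : D.multiIdx) :
    D.formMul (D.x α i) (D.x β j) = D.form α β • (D.x α i * D.x β j) := by
  rw [formMul, ← D.xBasis_apply (α, i), Module.Basis.constr_basis, ← D.xBasis_apply (β, j),
    Module.Basis.constr_basis]
  simp only [xBasis_apply]

theorem lower_add_left (p : Fin (m + 1) × Fin 2) (i j : D.multiIdx) (h : i.1 p ≠ 0) :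
    D.lower p (i + j) = D.lower p i + j := by
  apply Subtype.ext
  funext q
  by_cases hq : q = p
  · subst hq; simp [lower]; omega
  · simp [lower, Function.update_of_ne hq]

theorem lower_add_right (p : Fin (m + 1) × Fin 2) (i j : D.multiIdx) (h : j.1 p ≠ 0) :
    D.lower p (i + j) = i + D.lower p j := by
  have := D.lower_add_left p j i h
  rwa [add_comm j i, add_comm _ i] at this

theorem lower_comm (p q : Fin (m + 1) × Fin 2) (i : D.multiIdx) :
    D.lower p (D.lower q i) = D.lower q (D.lower p i) := by
  apply Subtype.ext
  by_cases h : p = q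
  · rw [h]
  · simp only [lower]
    rw [Function.update_of_ne h, Function.update_of_ne (Ne.symm h), Function.update_comm h]

theorem lower_apply_ne (p q : Fin (m + 1) × Fin 2) (i : D.multiIdx) (h : q ≠ p) :
    (D.lower p i).1 q = i.1 q := by
  simp [lower, Function.update_of_ne h]

theorem x_induction {P : D.Alg → Prop} (hx : ∀ α i, P (D.x α i))
    (hadd : ∀ u v, P u → P v → P (u + v)) (hsmul : ∀ (c : F) u, P u → P (c • u)) (u : D.Alg) :
    P u := by
  have hu := D.xBasis.mem_span u
  induction hu using Submodule.span_induction with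
  | mem y hy => obtain ⟨a, rfl⟩ := hy; rw [xBasis_apply]; exact hx _ _
  | zero => simpa using hsmul 0 _ (hx 0 0)
  | add y z _ _ hy hz => exact hadd _ _ hy hz
  | smul c y _ hy => exact hsmul _ _ hy

theorem del_leibniz (p : Fin (m + 1) × Fin 2) (u v : D.Alg) :
    D.del p (u * v) = u * D.del p v + v * D.del p u := by
  induction u using D.x_induction with
  | hadd u u' h h' => simp only [add_mul, mul_add, map_add, h, h']; ring
  | hsmul c u h => simp only [smul_mul_assoc, mul_smul_comm, map_smul, h, smul_add]
  | hx α i =>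
    induction v using D.x_induction with
    | hadd u u' h h' => simp only [add_mul, mul_add, map_add, h, h']; ring
    | hsmul c u h => simp only [smul_mul_assoc, mul_smul_comm, map_smul, h, smul_add]
    | hx β j =>
      have e1 : (i.1 p : F) • D.x (α + β) (D.lower p (i + j))
          = (i.1 p : F) • D.x (α + β) (D.lower p i + j) := by
        by_cases h : i.1 p = 0
        · simp [h]
        · rw [D.lower_add_left p i j h]
      have e2 : (j.1 p : F) • D.x (α + β) (D.lower p (i + j))
          = (j.1 p : F) • D.x (α + β) (i + D.lower p j) := by
        by_cases h : j.1 p = 0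
        · simp [h]
        · rw [D.lower_add_right p i j h]
      have e3 : ((i + j).1 p : F) = i.1 p + j.1 p := by
        simp [AddSubmonoid.coe_add]
      simp only [x_mul_x, del_x, mul_add, mul_smul_comm, e3, map_add, add_smul, e1, e2]
      rw [add_comm β α, add_comm j i, add_comm j]
      abel

/-- `∂_p` as a derivation of the commutative algebra `𝒜`. -/
def delDer (p : Fin (m + 1) × Fin 2) : Derivation F D.Alg D.Alg :=
  Derivation.mk' (D.del p) (D.del_leibniz p)

theorem delDer_apply (p : Fin (m + 1) × Fin 2) (u : D.Alg) : D.delDer p u = D.del p u := rfl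

theorem del_comm (p q : Fin (m + 1) × Fin 2) (u : D.Alg) :
    D.del p (D.del q u) = D.del q (D.del p u) := by
  induction u using D.x_induction with
  | hadd u u' h h' => simp only [map_add, h, h']
  | hsmul c u h => simp only [map_smul, h]
  | hx α i =>
    by_cases h : p = q
    · rw [h]
    · simp only [del_x, map_add, map_smul, smul_add, D.lower_apply_ne q p i h,
        D.lower_apply_ne p q i (Ne.symm h), D.lower_comm q p, smul_smul]
      simp only [mul_comm]
      abel

theorem del_x_zero (p : Fin (m + 1) × Fin 2) (α : Γ) :
    D.del p (D.x α 0) = D.weight p α • D.x α 0 := by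
  simp [del_x]

theorem formMul_skew (u w : D.Alg) : D.formMul u w = -D.formMul w u := by
  induction u using D.x_induction with
  | hadd u u' h h' => simp only [map_add, LinearMap.add_apply, h, h']; abel
  | hsmul c u h => simp only [map_smul, LinearMap.smul_apply, h, smul_neg]
  | hx α i =>
    induction w using D.x_induction with
    | hadd u u' h h' => simp only [map_add, LinearMap.add_apply, h, h']; abel
    | hsmul c u h => simp only [map_smul, LinearMap.smul_apply, h, smul_neg]
    | hx β j => rw [formMul_x, formMul_x, D.form_skew α β, mul_comm, neg_smul]

theorem formMul_mul (u v w : D.Alg) :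
    D.formMul u (v * w) = v * D.formMul u w + w * D.formMul u v := by
  induction u using D.x_induction with
  | hadd u u' h h' => simp only [map_add, LinearMap.add_apply, h, h', mul_add]; abel
  | hsmul c u h => simp only [map_smul, LinearMap.smul_apply, h, mul_smul_comm, smul_add]
  | hx α i =>
    induction v using D.x_induction with
    | hadd u u' h h' => simp only [add_mul, map_add, h, h', mul_add]; abel
    | hsmul c u h => simp only [smul_mul_assoc, map_smul, h, mul_smul_comm, smul_add]
    | hx β j =>
      induction w using D.x_induction with
      | hadd u u' h h' => simp only [add_mul, map_add, h, h', mul_add]; abel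
      | hsmul c u h => simp only [smul_mul_assoc, map_smul, h, mul_smul_comm, smul_add]
      | hx γ k =>
        rw [x_mul_x, formMul_x, formMul_x, formMul_x, ← x_mul_x, map_add, add_smul,
          mul_smul_comm, mul_smul_comm, add_comm]
        congr 2 <;> ring

theorem formMul_jacobi (u v w : D.Alg) :
    D.formMul u (D.formMul v w) + D.formMul v (D.formMul w u) + D.formMul w (D.formMul u v)
      = 0 := by
  induction u using D.x_induction with
  | hadd u u' h h' =>
    simp only [map_add, LinearMap.add_apply]
    linear_combination h + h'
  | hsmul c u h => simp only [map_smul, LinearMap.smul_apply, ← smul_add, h, smul_zero]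
  | hx α i =>
    induction v using D.x_induction with
    | hadd u u' h h' =>
      simp only [map_add, LinearMap.add_apply]
      linear_combination h + h'
    | hsmul c u h => simp only [map_smul, LinearMap.smul_apply, ← smul_add, h, smul_zero]
    | hx β j =>
      induction w using D.x_induction with
      | hadd u u' h h' =>
        simp only [map_add, LinearMap.add_apply]
        linear_combination h + h'
      | hsmul c u h => simp only [map_smul, LinearMap.smul_apply, ← smul_add, h, smul_zero]
      | hx γ k =>
        have e1 : D.x β j * (D.x γ k * D.x α i) = D.x α i * (D.x β j * D.x γ k) := by ring
        have e2 : D.x γ k * (D.x α i * D.x β j) = D.x α i * (D.x β j * D.x γ k) := by ring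
        rw [formMul_x, formMul_x, formMul_x, map_smul, map_smul, map_smul, x_mul_x, x_mul_x,
          x_mul_x, formMul_x, formMul_x, formMul_x, ← x_mul_x, ← x_mul_x, ← x_mul_x, e1, e2]
        simp only [smul_smul, ← add_smul, map_add]
        rw [D.form_skew β α, D.form_skew γ α, D.form_skew γ β]
        convert zero_smul F _ using 2
        ring

theorem del_formMul (p : Fin (m + 1) × Fin 2) (u v : D.Alg) :
    D.del p (D.formMul u v) = D.formMul (D.del p u) v + D.formMul u (D.del p v) := by
  induction u using D.x_induction with
  | hadd u u' h h' => simp only [map_add, LinearMap.add_apply, h, h']; abel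
  | hsmul c u h => simp only [map_smul, LinearMap.smul_apply, h, smul_add]
  | hx α i =>
    induction v using D.x_induction with
    | hadd u u' h h' => simp only [map_add, h, h']; abel
    | hsmul c u h => simp only [map_smul, h, smul_add]
    | hx β j =>
      simp only [formMul_x, del_x, map_add, map_smul, LinearMap.add_apply, LinearMap.smul_apply,
        del_leibniz, smul_add, mul_add, mul_smul_comm, smul_smul]
      simp only [mul_comm]
      abel

theorem formMul_radical (u : D.Alg) (α : Γ) (hα : α ∈ D.form.ker) :
    D.formMul u (D.x α 0) = 0 := by
  induction u using D.x_induction with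
  | hadd u u' h h' => simp only [map_add, LinearMap.add_apply, h, h', add_zero]
  | hsmul c u h => simp only [map_smul, LinearMap.smul_apply, h, smul_zero]
  | hx β i =>
    have h : D.form α = 0 := hα
    rw [formMul_x, D.form_skew, h]
    simp

def coefF : Fin (m + 1) → D.Alg :=
  Fin.cases 1 fun t => D.x D.ε 0 * D.x (D.σ t) 0

def coefC : Fin (m + 1) → D.Alg := Fin.cases 1 fun _ => 0

def pc (k : Fin (m + 1)) (u w : D.Alg) : D.Alg :=
  piece (D.coefF k) (D.coefC k) (D.delDer (k, 0)) (D.delDer (k, 1)) u w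

theorem br_eq (u w : D.Alg) :
    D.br u w = (∑ k, D.pc k u w) + D.x D.ε 0 * D.formMul u w := by
  rw [Fin.sum_univ_succ]
  simp only [br, pc, piece, coefF, coefC, Fin.cases_zero, Fin.cases_succ, delDer_apply, mul_add,
    Finset.mul_sum, one_mul, zero_mul, add_zero, mul_assoc]
  ring

theorem weight_succ_ε (t : Fin m) (i : Fin 2) : D.weight (t.succ, i) D.ε = 0 :=
  D.weight_ε _ fun h => Fin.succ_ne_zero t (congrArg Prod.fst h)

theorem weight_one_ε : D.weight (0, 1) D.ε = 0 :=
  D.weight_ε _ fun h => one_ne_zero (congrArg Prod.snd h)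

theorem coefC_const (k : Fin (m + 1)) (p : Fin (m + 1) × Fin 2) :
    D.delDer p (D.coefC k) = 0 := by
  cases k using Fin.cases with
  | zero => simp [coefC]
  | succ t => simp [coefC]

theorem formMul_one (u : D.Alg) : D.formMul u 1 = 0 := by
  have := D.formMul_mul u 1 1
  simpa using this

theorem pc_cross (k l : Fin (m + 1)) (u v w : D.Alg) :
    (D.pc k u (D.pc l v w) + D.pc k v (D.pc l w u) + D.pc k w (D.pc l u v))
    + (D.pc l u (D.pc k v w) + D.pc l v (D.pc k w u) + D.pc l w (D.pc k u v)) = 0 := by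
  have hcomm : ∀ p q u, D.delDer p (D.delDer q u) = D.delDer q (D.delDer p u) := D.del_comm
  by_cases hkl : k = l
  · subst hkl
    have h : D.pc k u (D.pc k v w) + D.pc k v (D.pc k w u) + D.pc k w (D.pc k u v) = 0 :=
      piece_self _ _ _ _ (hcomm _ _) (D.coefC_const _ _) (D.coefC_const _ _) u v w
    rw [h, add_zero]
  · have key : ∀ k l : Fin (m + 1), k ≠ l →
        D.delDer (k, 0) (D.coefF l) = D.coefC k * D.coefF l ∧
        D.delDer (k, 1) (D.coefF l) = 0 := by
      intro k l h
      cases l using Fin.cases with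
      | zero =>
        cases k using Fin.cases with
        | zero => exact absurd rfl h
        | succ t => simp [coefF, coefC]
      | succ s =>
        have hσ : ∀ i, D.weight (k, i) (D.σ s) = 0 := fun i => D.weight_σ s _ h
        cases k using Fin.cases with
        | zero =>
          simp [coefF, coefC, delDer_apply, x_mul_x, del_x_zero, hσ, weight_one_ε,
            D.weight_zero_ε]
        | succ t =>
          simp [coefF, coefC, delDer_apply, x_mul_x, del_x_zero, hσ, weight_succ_ε]
    exact piece_cross _ _ _ _ _ _ _ _ (hcomm _ _) (hcomm _ _) (hcomm _ _) (hcomm _ _)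
      (D.coefC_const _ _) (D.coefC_const _ _) (D.coefC_const _ _) (D.coefC_const _ _)
      (key k l hkl).1 (key k l hkl).2 (key l k (Ne.symm hkl)).1 (key l k (Ne.symm hkl)).2 u v w

theorem pc_form (k : Fin (m + 1)) (u v w : D.Alg) :
    (D.pc k u (D.x D.ε 0 * D.formMul v w) + D.pc k v (D.x D.ε 0 * D.formMul w u)
      + D.pc k w (D.x D.ε 0 * D.formMul u v))
    + (D.x D.ε 0 * D.formMul u (D.pc k v w) + D.x D.ε 0 * D.formMul v (D.pc k w u)
      + D.x D.ε 0 * D.formMul w (D.pc k u v)) = 0 := by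
  refine piece_form _ _ _ _ _ D.formMul D.formMul_skew D.formMul_mul (D.del_formMul _)
    (D.del_formMul _) ?_ ?_ ?_ ?_ u v w
  · intro u
    cases k using Fin.cases with
    | zero => exact D.formMul_one u
    | succ t =>
      simp only [coefF, Fin.cases_succ, formMul_mul, D.formMul_radical u _ D.ε_mem,
        D.formMul_radical u _ (D.σ_mem t), mul_zero, add_zero]
  · intro u
    cases k using Fin.cases with
    | zero => exact D.formMul_one u
    | succ t => simp [coefC]
  · cases k using Fin.cases with
    | zero => simp [coefC, delDer_apply, del_x_zero, D.weight_zero_ε]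
    | succ t => simp [coefC, delDer_apply, del_x_zero, weight_succ_ε]
  · cases k using Fin.cases with
    | zero => simp [delDer_apply, del_x_zero, weight_one_ε]
    | succ t => simp [delDer_apply, del_x_zero, weight_succ_ε]

theorem br_add_right (u v w : D.Alg) : D.br u (v + w) = D.br u v + D.br u w := by
  simp only [br, map_add, mul_add, add_mul, sub_eq_add_neg, neg_add, Finset.sum_add_distrib]
  ring

theorem br_smul_right (c : F) (u w : D.Alg) : D.br u (c • w) = c • D.br u w := by
  simp only [br, map_smul, ← smul_add, mul_smul_comm, smul_mul_assoc, ← smul_sub,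
    ← Finset.smul_sum]

theorem br_skew (u w : D.Alg) : D.br u w = -D.br w u := by
  rw [br_eq, br_eq, D.formMul_skew u w, neg_add, ← Finset.sum_neg_distrib, mul_neg]
  congr 1
  refine Finset.sum_congr rfl fun k _ => ?_
  simp only [pc, piece]
  ring

theorem br_x_neg_ε (u : D.Alg) : D.br u (D.x (-D.ε) 0) = 0 := by
  have h : -D.ε ∈ D.form.ker := neg_mem D.ε_mem
  simp [br, del_x_zero, weight_succ_ε, weight_one_ε, D.weight_zero_ε, D.formMul_radical u _ h]

theorem br_add_left (u v w : D.Alg) : D.br (u + v) w = D.br u w + D.br v w := by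
  rw [br_skew, br_add_right, D.br_skew u w, D.br_skew v w, neg_add]

variable [CharZero F]

theorem br_self (u : D.Alg) : D.br u u = 0 := by
  have h := D.br_skew u u
  rw [eq_neg_iff_add_eq_zero, ← two_smul F] at h
  exact (smul_eq_zero.mp h).resolve_left two_ne_zero

theorem br_jacobi (u v w : D.Alg) :
    D.br u (D.br v w) + D.br v (D.br w u) + D.br w (D.br u v) = 0 := by
  have hpc : ∀ u v w : D.Alg, ∑ k, D.pc k u ((∑ l, D.pc l v w) + D.x D.ε 0 * D.formMul v w)
      = ∑ k, ∑ l, D.pc k u (D.pc l v w) + ∑ k, D.pc k u (D.x D.ε 0 * D.formMul v w) := by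
    intro u v w
    rw [← Finset.sum_add_distrib]
    refine Finset.sum_congr rfl fun k _ => ?_
    simp only [pc, piece_add_right, piece_sum_right]
  have h1 : (∑ k, ∑ l, D.pc k u (D.pc l v w)) + (∑ k, ∑ l, D.pc k v (D.pc l w u))
      + (∑ k, ∑ l, D.pc k w (D.pc l u v)) = 0 := by
    simp only [← Finset.sum_add_distrib]
    set S : D.Alg := ∑ k, ∑ l,
      (D.pc k u (D.pc l v w) + D.pc k v (D.pc l w u) + D.pc k w (D.pc l u v)) with hS
    have h : S + S = 0 := by
      nth_rewrite 2 [hS]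
      rw [Finset.sum_comm, hS]
      simp only [← Finset.sum_add_distrib]
      exact Finset.sum_eq_zero fun k _ => Finset.sum_eq_zero fun l _ => D.pc_cross k l u v w
    rw [← two_smul F] at h
    exact (smul_eq_zero.mp h).resolve_left two_ne_zero
  have h2 := Finset.sum_eq_zero fun k (_ : k ∈ Finset.univ) => D.pc_form k u v w
  simp only [Finset.sum_add_distrib] at h2
  have h3 := D.formMul_jacobi u v w
  simp only [br_eq, hpc, map_add, map_sum, mul_add, Finset.mul_sum, formMul_mul,
    D.formMul_radical _ _ D.ε_mem, mul_zero, add_zero]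
  linear_combination h1 + h2 + (D.x D.ε 0 * D.x D.ε 0) * h3

theorem br_leibniz (u v w : D.Alg) :
    D.br u (D.br v w) = D.br (D.br u v) w + D.br v (D.br u w) := by
  have hneg : D.br v (D.br u w) = -D.br v (D.br w u) := by
    rw [D.br_skew u w, ← neg_one_smul F, br_smul_right, neg_one_smul]
  rw [D.br_skew (D.br u v) w, hneg]
  linear_combination D.br_jacobi u v w

/-- The Lie algebra `(𝒜, [·,·])`: the vector space `𝒜` with the bracket `br` (and not with the
commutator of the associative product). -/
def LieAlg : Type _ := D.Alg

instance : AddCommGroup D.LieAlg := inferInstanceAs (AddCommGroup D.Alg)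

instance : Module F D.LieAlg := inferInstanceAs (Module F D.Alg)

instance : LieRing D.LieAlg where
  bracket u w := D.br u w
  add_lie u v w := D.br_add_left u v w
  lie_add u v w := D.br_add_right u v w
  lie_self u := D.br_self u
  leibniz_lie u v w := D.br_leibniz u v w

instance : LieAlgebra F D.LieAlg where
  lie_smul c u w := D.br_smul_right c u w

/-- The identity map, from `𝒜` as an associative algebra to `𝒜` as a Lie algebra. -/
def toLie : D.Alg ≃ₗ[F] D.LieAlg := LinearEquiv.refl F D.Alg

theorem toLie_lie (u w : D.Alg) : ⁅D.toLie u, D.toLie w⁆ = D.toLie (D.br u w) := rfl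

/-- The basis element `x^{α,i}`, as an element of the Lie algebra. -/
def xLie (α : Γ) (i : D.multiIdx) : D.LieAlg := D.toLie (D.x α i)

/-- The line `F x^{-ε,0}`, an ideal because `x^{-ε,0}` is central. -/
def centralLine : LieIdeal F D.LieAlg where
  __ := Submodule.span F {D.xLie (-D.ε) 0}
  lie_mem {u w} hw := by
    obtain ⟨c, rfl⟩ := Submodule.mem_span_singleton.mp hw
    have h : ⁅u, c • D.xLie (-D.ε) 0⁆ = 0 := by
      have h0 : ⁅u, D.xLie (-D.ε) 0⁆ = 0 := D.br_x_neg_ε u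
      rw [lie_smul, h0, smul_zero]
    rw [h]
    exact Submodule.zero_mem _

/-- The twisted Hamiltonian Lie algebra `ℋ = 𝒜 / F x^{-ε,0}`. -/
abbrev TwistedHamiltonian : Type _ := D.LieAlg ⧸ D.centralLine

/-- The derived algebra `ℋ^{(1)} = [ℋ, ℋ]`. -/
abbrev derivedAlg : LieIdeal F D.TwistedHamiltonian :=
  ⁅(⊤ : LieIdeal F D.TwistedHamiltonian), (⊤ : LieIdeal F D.TwistedHamiltonian)⁆

/-- `σ = ∑_{s=1}^{n-1} σ_{2s+1} - 2ε`. -/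
def sigma : Γ := (∑ t, D.σ t) - 2 • D.ε

/-- The image in `ℋ` of the subspace `F x^{σ,0} + F x^{-ε,0}` of `𝒜`. -/
def sigmaLine : Submodule F D.TwistedHamiltonian :=
  (Submodule.span F {D.xLie D.sigma 0} ⊔ Submodule.span F {D.xLie (-D.ε) 0}).map
    (LieSubmodule.Quotient.mk' D.centralLine : D.LieAlg →ₗ[F] D.TwistedHamiltonian)

end

end TwistedHamiltonianData

/-! Since `φ_1(-ε) = -1`, conjugating by multiplication with `x^{-ε,0}` turns `∂_1 + 1` into `∂_1`,
and the twisted bracket becomes an honest Poisson bracket `{·,·}` on `𝒜` (`br_shift`). Under this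
map `1` goes to `x^{-ε,0}`, so `ℋ` is `𝒜/F·1` with the Poisson bracket.

Simplicity then follows from a Herstein-type argument (`Stable.le_const_or_derived_le`). In a
reduced Poisson algebra of characteristic 0 that has no nontrivial Poisson ideals and has centre
`F·1`, a Lie ideal of `K ⊇ {A,A}` either lies in `F·1` or contains `{A,A}`, provided that `A` is
generated by elements `a` with `a, a², a³ ∈ K`.

For `𝒜` the hypotheses are checked as follows. It is a domain because `Γ` is torsion-free. Each
`∂_p` is a multiple of some `{b,·}`, so Poisson ideals are stable under all `∂_p` and under the
operators `x^{α,i} ↦ φ(β,α) x^{α,i}`. Conditions (i)-(iii) make the joint weights separate the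
points of `Γ`, which gives `centralConst` and `isPoissonSimple`.

If some `𝒥_p = ℕ`, then `∂_p` is onto and `{𝒜,𝒜} = 𝒜`. If `𝒥 = 0`, then `{𝒜,𝒜}` is the hyperplane on
which the coefficient of `x^{ρ,0}` vanishes, with `ρ = shiftSum = σ + ε` (`mem_derived_iff`). This
gives the complement, and `K = {𝒜,𝒜}` still contains enough powers (`adjoin_powersIn_derived`). -/

/-! ### Lie ideals of Poisson algebras. -/

/-- A Poisson bracket on a commutative algebra. -/
structure PoissonBracket (F A : Type*) [Field F] [CommRing A] [Algebra F A] where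
  /-- the bracket, as a bilinear map -/
  toFun : A →ₗ[F] A →ₗ[F] A
  skew : ∀ a b, toFun a b = -toFun b a
  leibniz : ∀ a b c, toFun a (b * c) = b * toFun a c + c * toFun a b
  jacobi : ∀ a b c, toFun a (toFun b c) = toFun (toFun a b) c + toFun b (toFun a c)

namespace PoissonBracket

variable {F A : Type*} [Field F] [CommRing A] [Algebra F A] (P : PoissonBracket F A)

instance : CoeFun (PoissonBracket F A) fun _ => A → A →ₗ[F] A := ⟨fun P => ⇑P.toFun⟩

theorem add_right (a b c : A) : P a (b + c) = P a b + P a c := map_add _ _ _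

theorem add_left (a b c : A) : P (a + b) c = P a c + P b c := by simp

theorem smul_right (r : F) (a b : A) : P a (r • b) = r • P a b := map_smul _ _ _

theorem leibniz_left (a b c : A) : P (a * b) c = a * P b c + b * P a c := by
  rw [P.skew, P.leibniz, P.skew c b, P.skew c a]; ring

theorem one_right (a : A) : P a 1 = 0 := by
  have := P.leibniz a 1 1
  simpa using this

theorem const_right (a : A) (r : F) : P a (algebraMap F A r) = 0 := by
  rw [Algebra.algebraMap_eq_smul_one, P.smul_right, P.one_right, smul_zero]

/-- This identity makes every transporter closed under multiplication, although it is defined by a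
purely Lie-theoretic condition. -/
theorem mul_transfer (x y a : A) : P (x * y) a = P x (y * a) + P y (a * x) := by
  rw [P.leibniz_left, P.leibniz, P.leibniz, P.skew y x]; ring

/-- The span `{A, A}` of all brackets. -/
def derived : Submodule F A := Submodule.span F {c | ∃ a b, P a b = c}

theorem mem_derived (a b : A) : P a b ∈ P.derived := Submodule.subset_span ⟨a, b, rfl⟩

/-- The elements `x` with `{x, A} ⊆ M`. -/
def transporter (M : Submodule F A) : Submodule F A where
  carrier := {x | ∀ a, P x a ∈ M}
  add_mem' hx hy a := by rw [P.add_left]; exact M.add_mem (hx a) (hy a)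
  zero_mem' a := by simp
  smul_mem' r x hx a := by simpa using M.smul_mem r (hx a)

theorem mul_mem_transporter {M : Submodule F A} {x y : A} (hx : x ∈ P.transporter M)
    (hy : y ∈ P.transporter M) : x * y ∈ P.transporter M := fun a => by
  rw [P.mul_transfer]; exact M.add_mem (hx _) (hy _)

/-- `N` is stable under the bracket with elements of `K`. -/
def Stable (K N : Submodule F A) : Prop := ∀ d ∈ K, ∀ x ∈ N, P d x ∈ N

variable {P}

theorem Stable.transporter {K M : Submodule F A} (h : P.Stable K M) :
    P.Stable K (P.transporter M) := fun d hd x hx a => by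
  have := P.jacobi d x a
  rw [eq_comm, ← eq_sub_iff_add_eq] at this
  rw [this]
  exact M.sub_mem (h d hd _ (hx a)) (hx _)

/-- `1` generates the centre of a Poisson algebra. -/
def CentralConst (P : PoissonBracket F A) : Prop :=
  ∀ u, (∀ a, P u a = 0) → u ∈ Submodule.span F {(1 : A)}

theorem right_eq_zero_of_mem_const (P : PoissonBracket F A) {u : A}
    (hu : u ∈ Submodule.span F {(1 : A)}) (a : A) : P a u = 0 := by
  obtain ⟨r, rfl⟩ := Submodule.mem_span_singleton.mp hu
  rw [P.smul_right, P.one_right, smul_zero]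

/-- The elements whose first three powers lie in `K`. -/
def powersIn (K : Submodule F A) : Set A := {a | a ∈ K ∧ a ^ 2 ∈ K ∧ a ^ 3 ∈ K}

/-- Write `δ = {u,·}`, a derivation, and suppose `δa ≠ 0`. Then a constant annihilating `δa` is
zero. From `δ³(a²) = 6 δ²(a) δ(a) = 0` one gets `δ²(a) = 0`. Now `δ²(a²) = 2(δa)²` is a constant and
`δ³(a³) = 6(δa)³ = 0`, so `(δa)² = 0`, against reducedness. -/
theorem eq_zero_of_sq_const [CharZero F] [IsReduced A] (P : PoissonBracket F A)
    (u a : A) (h1 : P u (P u a) ∈ Submodule.span F {(1 : A)})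
    (h2 : P u (P u (a ^ 2)) ∈ Submodule.span F {(1 : A)})
    (h3 : P u (P u (a ^ 3)) ∈ Submodule.span F {(1 : A)}) : P u a = 0 := by
  by_contra hne
  have key : ∀ (c : A), c ∈ Submodule.span F {(1 : A)} → c * P u a = 0 → c = 0 := by
    intro c hc h
    obtain ⟨r, rfl⟩ := Submodule.mem_span_singleton.mp hc
    rw [smul_mul_assoc, one_mul, smul_eq_zero] at h
    rw [h.resolve_right hne, zero_smul]
  have nat : ∀ (k : ℕ) (c : A), c ∈ Submodule.span F {(1 : A)} → k ≠ 0 →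
      k * (c * P u a) = 0 → c = 0 := by
    intro k c hc hk h
    refine key c hc ?_
    rw [← nsmul_eq_mul, ← Nat.cast_smul_eq_nsmul F, smul_eq_zero] at h
    exact h.resolve_left (by exact_mod_cast hk)
  set c := P u (P u a) with hc
  have h1' := P.right_eq_zero_of_mem_const h1 u
  have h2' := P.right_eq_zero_of_mem_const h2 u
  have h3' := P.right_eq_zero_of_mem_const h3 u
  have c0 : c = 0 := by
    refine nat 6 c h1 (by norm_num) ?_
    have e : P u (P u (P u (a ^ 2))) = 6 * (c * P u a) := by
      rw [pow_two]
      simp only [P.leibniz, P.add_right, ← hc, h1']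
      ring
    push_cast
    rw [← e, h2']
  have e2 : P u (P u (a ^ 2)) = 2 * (P u a) ^ 2 := by
    rw [pow_two]
    simp only [P.leibniz, P.add_right, ← hc, c0]
    ring
  have e3 : P u (P u (P u (a ^ 3))) = 6 * (P u a) ^ 2 * P u a := by
    rw [pow_succ, pow_two]
    simp only [P.leibniz, P.add_right, ← hc, c0]
    rw [c0] at h1'
    simp only [h1']
    ring
  have hz : P u (P u (a ^ 2)) = 0 := by
    refine nat 3 _ h2 (by norm_num) ?_
    rw [e2, ← h3', e3]
    push_cast; ring
  rw [e2] at hz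
  have : (P u a) ^ 2 = 0 := by
    have h := hz
    rw [show (2 : A) = ((2 : ℕ) : A) by norm_num, ← nsmul_eq_mul,
      ← Nat.cast_smul_eq_nsmul F, smul_eq_zero] at h
    exact h.resolve_left (by norm_num)
  exact hne (pow_eq_zero_iff (two_ne_zero) |>.mp this)

theorem forall_of_adjoin {K : Submodule F A}
    (hK : Algebra.adjoin F (powersIn K) = ⊤) {Q : A → Prop}
    (hbase : ∀ a ∈ powersIn K, Q a) (hc : ∀ r : F, Q (algebraMap F A r))
    (hadd : ∀ a b, Q a → Q b → Q (a + b)) (hmul : ∀ a b, Q a → Q b → Q (a * b)) (a : A) :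
    Q a := by
  have ha : a ∈ Algebra.adjoin F (powersIn K) := by rw [hK]; trivial
  induction ha using Algebra.adjoin_induction with
  | mem x hx => exact hbase x hx
  | algebraMap r => exact hc r
  | add x y _ _ hx hy => exact hadd x y hx hy
  | mul x y _ _ hx hy => exact hmul x y hx hy

/-- For `u ∈ N` and `d ∈ K` the element `{u,d}` lies in `N`, so `{u,{u,d}}` is constant. Hence the
derivation `{u,·}` kills every generator in `powersIn K`, therefore all of `A`, and `u` is central.
-/
theorem Stable.le_const_of_bracket_const [CharZero F] [IsReduced A] (hP : P.CentralConst)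
    {K : Submodule F A} (hK : Algebra.adjoin F (powersIn K) = ⊤) {N : Submodule F A}
    (hN : P.Stable K N) (h : ∀ u ∈ N, ∀ v ∈ N, P u v ∈ Submodule.span F {(1 : A)}) :
    N ≤ Submodule.span F {(1 : A)} := by
  intro u hu
  have hd : ∀ d ∈ K, P u (P u d) ∈ Submodule.span F {(1 : A)} := by
    intro d hd
    rw [P.skew u d, ← neg_one_smul F, P.smul_right]
    exact Submodule.smul_mem _ _ (h u hu _ (hN d hd u hu))
  refine hP u (forall_of_adjoin hK ?_ ?_ ?_ ?_)
  · rintro a ⟨h1, h2, h3⟩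
    exact P.eq_zero_of_sq_const u a (hd _ h1) (hd _ h2) (hd _ h3)
  · exact P.const_right u
  · intro a b ha hb
    rw [P.add_right, ha, hb, add_zero]
  · intro a b ha hb
    rw [P.leibniz, ha, hb, mul_zero, mul_zero, add_zero]

/-- The only ideals stable under all brackets are the trivial ones. -/
def IsPoissonSimple (P : PoissonBracket F A) : Prop :=
  ∀ I : Ideal A, (∀ a, ∀ x ∈ I, P a x ∈ I) → I = ⊥ ∨ I = ⊤

/-- The largest ideal contained in a submodule. -/
def idealCore (S : Submodule F A) : Ideal A where
  carrier := {x | ∀ a, a * x ∈ S}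
  add_mem' hx hy a := by rw [mul_add]; exact S.add_mem (hx a) (hy a)
  zero_mem' a := by simp
  smul_mem' b x hx a := by rw [smul_eq_mul, ← mul_assoc]; exact hx _

/-- For `d ∈ K` this is `a{d,x} = {d,ax} - {d,a}x`. The Leibniz rule in the first argument extends
it from generators to all of `A`. -/
theorem Stable.idealCore_stable {K S : Submodule F A} (hK : Algebra.adjoin F (powersIn K) = ⊤)
    (hS : P.Stable K S) : ∀ a, ∀ x ∈ idealCore S, P a x ∈ idealCore S := by
  refine forall_of_adjoin hK ?_ ?_ ?_ ?_
  · rintro d ⟨hd, -⟩ x hx a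
    have e : a * P d x = P d (a * x) - P d a * x := by rw [P.leibniz]; ring
    rw [e]
    exact S.sub_mem (hS d hd _ (hx a)) (hx _)
  · intro r x _
    rw [P.skew, P.const_right, neg_zero]
    exact zero_mem _
  · intro a b ha hb x hx
    rw [P.add_left]
    exact add_mem (ha x hx) (hb x hx)
  · intro a b ha hb x hx
    rw [P.leibniz_left]
    exact add_mem (Ideal.mul_mem_left _ _ (hb x hx)) (Ideal.mul_mem_left _ _ (ha x hx))

/-- The Poisson analogue of Herstein's theorem on the Lie ideals of `[R, R]` in a simple ring. -/
theorem Stable.le_const_or_derived_le [CharZero F] [IsReduced A] (hP : P.CentralConst)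
    (hsimple : P.IsPoissonSimple) {K : Submodule F A}
    (hK : Algebra.adjoin F (powersIn K) = ⊤) (hder : P.derived ≤ K) {M : Submodule F A}
    (hMK : M ≤ K) (hM : P.Stable K M) :
    M ≤ Submodule.span F {(1 : A)} ∨ P.derived ≤ M := by
  set S := P.transporter M
  set T := P.transporter S
  have hS : P.Stable K S := hM.transporter
  have hT : P.Stable K T := hS.transporter
  -- By Jacobi, `{M,M} ⊆ S` and `{S,S} ⊆ T ∩ S`, so constancy can later be pulled back from `T ∩ S`
  -- to `S` and then to `M`.
  have hMM : ∀ u ∈ M, ∀ v ∈ M, P u v ∈ S := by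
    intro u hu v hv a
    have := P.jacobi u v a
    rw [eq_comm, ← eq_sub_iff_add_eq] at this
    rw [this]
    have h : ∀ u ∈ M, ∀ v ∈ M, P u (P v a) ∈ M := by
      intro u hu v hv
      rw [P.skew]
      exact M.neg_mem (hM _ (hder (P.mem_derived _ _)) u hu)
    exact M.sub_mem (h u hu v hv) (h v hv u hu)
  have hSM : ∀ x ∈ S, ∀ v ∈ M, P x v ∈ S := by
    intro x hx v hv
    rw [P.skew]
    exact S.neg_mem (hS v (hMK hv) x hx)
  have hSS : ∀ x ∈ S, ∀ y ∈ S, P x y ∈ T := by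
    intro x hx y hy a
    have := P.jacobi x y a
    rw [eq_comm, ← eq_sub_iff_add_eq] at this
    rw [this]
    exact S.sub_mem (hSM x hx _ (hy a)) (hSM y hy _ (hx a))
  -- Here `S` being closed under products matters: `a{x,y} = {x,ya} - y{x,a}`, and both terms lie in
  -- `S`.
  have hTT : ∀ x ∈ T, ∀ y ∈ T, y ∈ S → P x y ∈ idealCore S := by
    intro x hx y hy hyS a
    have e : a * P x y = P x (y * a) - y * P x a := by rw [P.leibniz]; ring
    rw [e]
    exact S.sub_mem (hx _) (P.mul_mem_transporter hyS (hx a))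
  -- If the core is zero, `T ∩ S` is abelian, and `le_const_of_bracket_const` applies in turn to `T
  -- ∩ S`, `S` and `M`. If it is everything, then `S = A`, which says `{A,A} ⊆ M`.
  rcases hsimple (idealCore S) (hS.idealCore_stable hK) with h | h
  · left
    have hT0 : ∀ x ∈ T ⊓ S, ∀ y ∈ T ⊓ S, P x y = 0 := by
      intro x hx y hy
      have := hTT x hx.1 y hy.1 hy.2
      rwa [h] at this
    have hconst : ∀ {N : Submodule F A}, P.Stable K N →
        (∀ u ∈ N, ∀ v ∈ N, P u v ∈ Submodule.span F {(1 : A)}) →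
        N ≤ Submodule.span F {(1 : A)} := fun h h' => h.le_const_of_bracket_const hP hK h'
    have hTc : T ⊓ S ≤ Submodule.span F {(1 : A)} := by
      refine hconst (fun d hd x hx => ⟨hT d hd x hx.1, hS d hd x hx.2⟩) fun u hu v hv => ?_
      rw [hT0 u hu v hv]
      exact zero_mem _
    have hSc : S ≤ Submodule.span F {(1 : A)} := by
      refine hconst hS fun u hu v hv => hTc ⟨hSS u hu v hv, fun a => ?_⟩
      have := P.jacobi u v a
      rw [eq_comm, ← eq_sub_iff_add_eq] at this
      rw [this]
      exact M.sub_mem (hu _) (hv _)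
    exact hconst hM fun u hu v hv => hSc (hMM u hu v hv)
  · right
    have h1 : ∀ a, a ∈ S := fun a => by
      have := (Ideal.eq_top_iff_one _).mp h
      simpa using this a
    refine Submodule.span_le.mpr ?_
    rintro _ ⟨a, b, rfl⟩
    exact h1 a b

end PoissonBracket

/-! ### The Poisson bracket behind the twisted bracket. -/

namespace TwistedHamiltonianData

noncomputable section

variable {F Γ : Type*} [Field F] [AddCommGroup Γ] {m : ℕ} (D : TwistedHamiltonianData F Γ m)

/-- A torsion-free abelian group embeds in its divisible hull, a rational vector space. The property
rules out zero divisors in the group algebra. -/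
theorem twoUniqueSums_of_torsionFree (G : Type*) [AddCommGroup G] [IsAddTorsionFree G] :
    TwoUniqueSums G :=
  .of_injective_addHom (DivisibleHull.coeAddMonoidHom G).toAddHom
    DivisibleHull.coe_injective inferInstance

theorem alg_noZeroDivisors [IsAddTorsionFree Γ] : NoZeroDivisors D.Alg := by
  have := twoUniqueSums_of_torsionFree Γ
  have : TwoUniqueSums D.multiIdx :=
    .of_injective_addHom D.multiIdx.subtype.toAddHom Subtype.val_injective inferInstance
  infer_instance

/-- The exponents of the structure coefficients of the Poisson bracket. -/
def shift : Fin (m + 1) → Γ := Fin.cases (-D.ε) D.σ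

theorem shift_mem (s : Fin (m + 1)) : D.shift s ∈ D.form.ker := by
  cases s using Fin.cases with
  | zero => exact neg_mem D.ε_mem
  | succ t => exact D.σ_mem t

theorem weight_shift (s : Fin (m + 1)) (p : Fin (m + 1) × Fin 2) (h : p.1 ≠ s) :
    D.weight p (D.shift s) = 0 := by
  cases s using Fin.cases with
  | zero =>
    have : p ≠ (0, 0) := fun e => h (by rw [e])
    simp [shift, D.weight_ε p this]
  | succ t => exact D.weight_σ t p h

/-- The bracket `br`, transported along multiplication by `x^{-ε,0}`. -/
def pois (u w : D.Alg) : D.Alg :=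
  (∑ s, D.x (D.shift s) 0 *
    (D.del (s, 0) u * D.del (s, 1) w - D.del (s, 0) w * D.del (s, 1) u)) + D.formMul u w

theorem x_zero_zero : D.x 0 0 = 1 := rfl

theorem x_neg_mul_x (α : Γ) : D.x (-α) 0 * D.x α 0 = 1 := by
  rw [x_mul_x, neg_add_cancel, add_zero, x_zero_zero]

theorem x_mul_x_neg (α : Γ) : D.x α 0 * D.x (-α) 0 = 1 := by
  rw [mul_comm, x_neg_mul_x]

theorem formMul_mul_left (u v w : D.Alg) :
    D.formMul (u * v) w = u * D.formMul v w + v * D.formMul u w := by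
  rw [D.formMul_skew, formMul_mul, D.formMul_skew w v, D.formMul_skew w u]; ring

/-- Every other `∂_p` and the form ignore `ε`, so only the first pair changes: it acquires the
coefficient `x^{-ε,0}`, which is why `shift` starts with `-ε`. Jacobi for `pois` is then inherited
from `br`. -/
theorem br_shift (u w : D.Alg) :
    D.br (D.x (-D.ε) 0 * u) (D.x (-D.ε) 0 * w) = D.x (-D.ε) 0 * D.pois u w := by
  have hε : ∀ u, D.formMul u (D.x (-D.ε) 0) = 0 :=
    fun u => D.formMul_radical u _ (neg_mem D.ε_mem)
  have hε' : ∀ u, D.formMul (D.x (-D.ε) 0) u = 0 := fun u => by rw [formMul_skew, hε, neg_zero]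
  have h1 := D.x_mul_x_neg D.ε
  simp only [br, pois, Fin.sum_univ_succ, shift, Fin.cases_zero, Fin.cases_succ, del_leibniz,
    del_x_zero, map_neg, weight_succ_ε, weight_one_ε, D.weight_zero_ε, neg_zero, zero_smul,
    mul_zero, add_zero, formMul_mul, formMul_mul_left, hε, hε', neg_smul, one_smul, mul_neg]
  have h2 : (∑ t : Fin m, D.x (D.σ t) 0 *
      (D.x (-D.ε) 0 * D.del (t.succ, 0) u * (D.x (-D.ε) 0 * D.del (t.succ, 1) w)
        - D.x (-D.ε) 0 * D.del (t.succ, 0) w * (D.x (-D.ε) 0 * D.del (t.succ, 1) u)))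
      = D.x (-D.ε) 0 * D.x (-D.ε) 0 * ∑ t : Fin m, D.x (D.σ t) 0 *
        (D.del (t.succ, 0) u * D.del (t.succ, 1) w
          - D.del (t.succ, 0) w * D.del (t.succ, 1) u) := by
    rw [Finset.mul_sum]
    exact Finset.sum_congr rfl fun t _ => by ring
  rw [h2]
  linear_combination (D.x (-D.ε) 0 * ((∑ t : Fin m, D.x (D.σ t) 0 *
        (D.del (t.succ, 0) u * D.del (t.succ, 1) w
          - D.del (t.succ, 0) w * D.del (t.succ, 1) u)) + D.formMul u w)) * h1

theorem pois_eq (u w : D.Alg) :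
    D.pois u w = D.x D.ε 0 * D.br (D.x (-D.ε) 0 * u) (D.x (-D.ε) 0 * w) := by
  rw [br_shift, ← mul_assoc, x_mul_x_neg, one_mul]

theorem x_neg_mul_pois (u w : D.Alg) : D.x (-D.ε) 0 * D.pois u w
    = D.br (D.x (-D.ε) 0 * u) (D.x (-D.ε) 0 * w) := (D.br_shift u w).symm

theorem pois_add_right (u v w : D.Alg) : D.pois u (v + w) = D.pois u v + D.pois u w := by
  rw [pois_eq, mul_add, br_add_right, mul_add, ← pois_eq, ← pois_eq]

theorem pois_smul_right (c : F) (u w : D.Alg) : D.pois u (c • w) = c • D.pois u w := by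
  rw [pois_eq, mul_smul_comm, br_smul_right, mul_smul_comm, ← pois_eq]

theorem pois_skew (u w : D.Alg) : D.pois u w = -D.pois w u := by
  rw [pois_eq, br_skew, mul_neg, ← pois_eq]

theorem pois_leibniz (u v w : D.Alg) :
    D.pois u (v * w) = v * D.pois u w + w * D.pois u v := by
  simp only [pois, formMul_mul, del_leibniz, mul_add, Finset.mul_sum]
  have : ∀ a b c d e : D.Alg, a = b + c → a + (d + e) = b + d + (c + e) := by
    intro a b c d e h; rw [h]; ring
  refine this _ _ _ _ _ ?_
  rw [← Finset.sum_add_distrib]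
  exact Finset.sum_congr rfl fun t _ => by ring

variable [CharZero F]

theorem pois_jacobi (u v w : D.Alg) :
    D.pois u (D.pois v w) = D.pois (D.pois u v) w + D.pois v (D.pois u w) := by
  rw [D.pois_eq u, D.pois_eq (D.pois u v), D.pois_eq v (D.pois u w)]
  simp only [x_neg_mul_pois]
  rw [br_leibniz, mul_add]

/-- The Poisson bracket on `𝒜` obtained by shifting the bracket of `𝒜` by `x^{-ε,0}`. -/
def poisson : PoissonBracket F D.Alg where
  toFun := LinearMap.mk₂ F D.pois
    (fun u v w => by rw [pois_skew, pois_add_right, D.pois_skew u w, D.pois_skew v w, neg_add])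
    (fun c u w => by rw [pois_skew, pois_smul_right, D.pois_skew u w, smul_neg])
    D.pois_add_right (fun c u w => D.pois_smul_right c u w)
  skew := D.pois_skew
  leibniz := D.pois_leibniz
  jacobi := D.pois_jacobi

theorem poisson_apply (u w : D.Alg) : D.poisson u w = D.pois u w := rfl

end

/-! ### Coefficients and joint eigenvectors of the operators `del p` and `diag β`. -/

noncomputable section

variable {F Γ : Type*} [Field F] [AddCommGroup Γ] {m : ℕ} (D : TwistedHamiltonianData F Γ m)

theorem mem_multiIdx (i : Fin (m + 1) × Fin 2 → ℕ) : i ∈ D.multiIdx ↔ ∀ p, i p ∈ D.J p := by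
  simp [multiIdx, AddSubmonoid.mem_pi]

theorem exists_raise {p : Fin (m + 1) × Fin 2} (hp : D.J p = ⊤) (i : D.multiIdx) :
    ∃ j : D.multiIdx, j.1 p = i.1 p + 1 ∧ D.lower p j = i := by
  refine ⟨⟨Function.update i.1 p (i.1 p + 1), (D.mem_multiIdx _).mpr fun q => ?_⟩, ?_, ?_⟩
  · by_cases h : q = p
    · subst h; simp [hp]
    · rw [Function.update_of_ne h]
      exact (D.mem_multiIdx _).mp i.2 q
  · simp
  · exact Subtype.ext (by simp [lower])

theorem lower_apply_self (p : Fin (m + 1) × Fin 2) (i : D.multiIdx) :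
    (D.lower p i).1 p = i.1 p - 1 := by
  simp [lower]

theorem eq_of_lower_eq {p : Fin (m + 1) × Fin 2} {i j : D.multiIdx} (hi : i.1 p ≠ 0)
    (hj : j.1 p ≠ 0) (h : D.lower p i = D.lower p j) : i = j := by
  refine Subtype.ext (funext fun q => ?_)
  by_cases hq : q = p
  · subst hq
    have := D.lower_apply_self q i
    rw [h, lower_apply_self] at this
    omega
  · rw [← D.lower_apply_ne p q i hq, h, D.lower_apply_ne p q j hq]

/-- The total degree of a multi-index. -/
def height (i : D.multiIdx) : ℕ := ∑ p, i.1 p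

theorem height_lower (p : Fin (m + 1) × Fin 2) (i : D.multiIdx) (h : i.1 p ≠ 0) :
    D.height i = D.height (D.lower p i) + 1 := by
  classical
  have e : i.1 = (D.lower p i).1 + Pi.single p 1 := by
    funext q
    by_cases hq : q = p
    · subst hq
      simp only [Pi.add_apply, lower_apply_self, Pi.single_eq_same]
      omega
    · simp [D.lower_apply_ne p q i hq, Pi.single_eq_of_ne hq]
  unfold height
  conv_lhs => rw [e]
  simp [Finset.sum_add_distrib]

theorem coeff_x (α : Γ) (i : D.multiIdx) (a : Γ × D.multiIdx) [Decidable ((α, i) = a)] :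
    (D.x α i).coeff a = if (α, i) = a then 1 else 0 := by
  rw [x, AddMonoidAlgebra.coeff_single, Finsupp.single_apply]

theorem coeff_del_lower (p : Fin (m + 1) × Fin 2) (u : D.Alg) (α : Γ) (i : D.multiIdx)
    (hi : i.1 p ≠ 0) : (D.del p u).coeff (α, D.lower p i)
      = D.weight p α * u.coeff (α, D.lower p i) + i.1 p * u.coeff (α, i) := by
  classical
  induction u using D.x_induction with
  | hadd u v hu hv =>
    simp only [map_add, AddMonoidAlgebra.coeff_add, Finsupp.add_apply, hu, hv]; ring
  | hsmul c u hu =>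
    simp only [map_smul, AddMonoidAlgebra.coeff_smul, Finsupp.smul_apply, hu, smul_eq_mul]; ring
  | hx β j =>
    simp only [del_x, AddMonoidAlgebra.coeff_add, Finsupp.add_apply, AddMonoidAlgebra.coeff_smul,
      Finsupp.smul_apply, coeff_x, smul_eq_mul, Prod.mk.injEq]
    congr 1
    · by_cases hβ : β = α
      · rw [hβ]
      · simp [hβ]
    · by_cases hβ : β = α
      · by_cases hij : j = i
        · simp [hβ, hij]
        · by_cases hj : j.1 p = 0
          · simp [hj, hij]
          · have : D.lower p j ≠ D.lower p i := fun h => hij (D.eq_of_lower_eq hj hi h)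
            simp [hij, this]
      · simp [hβ]

theorem coeff_del_of_forall_ne (p : Fin (m + 1) × Fin 2) (u : D.Alg) (α : Γ) (i : D.multiIdx)
    (hi : ∀ j : D.multiIdx, j.1 p ≠ 0 → D.lower p j ≠ i) :
    (D.del p u).coeff (α, i) = D.weight p α * u.coeff (α, i) := by
  classical
  induction u using D.x_induction with
  | hadd u v hu hv =>
    simp only [map_add, AddMonoidAlgebra.coeff_add, Finsupp.add_apply, hu, hv]; ring
  | hsmul c u hu =>
    simp only [map_smul, AddMonoidAlgebra.coeff_smul, Finsupp.smul_apply, hu, smul_eq_mul]; ring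
  | hx β j =>
    simp only [del_x, AddMonoidAlgebra.coeff_add, Finsupp.add_apply, AddMonoidAlgebra.coeff_smul,
      Finsupp.smul_apply, coeff_x, smul_eq_mul, Prod.mk.injEq]
    by_cases hβ : β = α
    · by_cases hj : j.1 p = 0
      · simp [hβ, hj]
      · simp [hβ, hi j hj]
    · simp [hβ]

/-- Triangularity: `∂_p` is diagonal up to terms of lower height, so at exponents not reached from
above it acts by its weight. -/
theorem coeff_del_of_top (p : Fin (m + 1) × Fin 2) (u : D.Alg) (α : Γ) (i : D.multiIdx)
    (hi : ∀ j : D.multiIdx, j.1 p ≠ 0 → D.lower p j = i → u.coeff (α, j) = 0) :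
    (D.del p u).coeff (α, i) = D.weight p α * u.coeff (α, i) := by
  by_cases h : ∃ j : D.multiIdx, j.1 p ≠ 0 ∧ D.lower p j = i
  · obtain ⟨j, hj, rfl⟩ := h
    rw [D.coeff_del_lower p u α j hj, hi j hj rfl, mul_zero, add_zero]
  · exact D.coeff_del_of_forall_ne p u α i fun j hj e => h ⟨j, hj, e⟩

/-- The diagonal operator `x^{α,i} ↦ φ(β, α) x^{α,i}`. -/
def diag (β : Γ) (u : D.Alg) : D.Alg := D.x (-β) 0 * D.formMul (D.x β 0) u

theorem diag_x (β α : Γ) (i : D.multiIdx) : D.diag β (D.x α i) = D.form β α • D.x α i := by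
  rw [diag, formMul_x, mul_smul_comm, ← mul_assoc, x_neg_mul_x, one_mul]

theorem diag_add (β : Γ) (u v : D.Alg) : D.diag β (u + v) = D.diag β u + D.diag β v := by
  simp [diag, mul_add]

theorem diag_smul (β : Γ) (c : F) (u : D.Alg) : D.diag β (c • u) = c • D.diag β u := by
  simp [diag]

theorem diag_mul (β : Γ) (u v : D.Alg) : D.diag β (u * v) = u * D.diag β v + v * D.diag β u := by
  simp only [diag, formMul_mul]; ring

theorem coeff_diag (β : Γ) (u : D.Alg) (a : Γ × D.multiIdx) :
    (D.diag β u).coeff a = D.form β a.1 * u.coeff a := by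
  classical
  induction u using D.x_induction with
  | hadd u v hu hv =>
    simp only [diag_add, AddMonoidAlgebra.coeff_add, Finsupp.add_apply, hu, hv]; ring
  | hsmul c u hu =>
    simp only [diag_smul, AddMonoidAlgebra.coeff_smul, Finsupp.smul_apply, hu, smul_eq_mul]; ring
  | hx α i =>
    simp only [diag_x, AddMonoidAlgebra.coeff_smul, Finsupp.smul_apply, coeff_x, smul_eq_mul]
    by_cases h : (α, i) = a
    · rw [← h]
    · simp [h]

theorem eq_zero_of_weights (γ : Γ) (h : ∀ β, D.form β γ = 0) (h' : ∀ p, D.weight p γ = 0) :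
    γ = 0 := by
  have : γ ∈ D.form.ker ⊓ (⨅ p, (D.weight p).ker) := by
    refine ⟨?_, ?_⟩
    · refine AddMonoidHom.ext fun β => ?_
      rw [D.form_skew, h, neg_zero]; rfl
    · exact AddSubgroup.mem_iInf.mpr fun p => h' p
  rwa [D.radical_inf_ker, AddSubgroup.mem_bot] at this

/-- At an exponent `(α,i)` of maximal height in the support all weights of `α` must vanish, so `α =
0`. If `i_p ≠ 0`, then `∂_p u` would have the nonzero coefficient `i_p u_{(0,i)}` one step lower. So
the maximal height is 0. -/
theorem mem_span_one [CharZero F] (u : D.Alg) (hdel : ∀ p, D.del p u = 0)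
    (hdiag : ∀ β, D.diag β u = 0) : u ∈ Submodule.span F {(1 : D.Alg)} := by
  classical
  by_cases hu : u = 0
  · rw [hu]; exact zero_mem _
  have hne : u.coeff.support.Nonempty := by
    rw [Finsupp.support_nonempty_iff]
    exact fun h => hu (AddMonoidAlgebra.coeff_eq_zero.mp h)
  obtain ⟨a, ha, hmax⟩ := Finset.exists_max_image u.coeff.support (fun a => D.height a.2) hne
  have top : ∀ b ∈ u.coeff.support, D.height b.2 = D.height a.2 → b.1 = 0 := by
    intro b hb hba
    have hb0 := Finsupp.mem_support_iff.mp hb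
    refine D.eq_zero_of_weights b.1 (fun β => ?_) fun p => ?_
    · have := D.coeff_diag β u b
      rw [hdiag] at this
      exact (mul_eq_zero.mp this.symm).resolve_right hb0
    · have := D.coeff_del_of_top p u b.1 b.2 ?_
      · rw [hdel] at this
        exact (mul_eq_zero.mp this.symm).resolve_right hb0
      · intro j hj hl
        by_contra hc
        have h1 := hmax (b.1, j) (Finsupp.mem_support_iff.mpr hc)
        have h2 := D.height_lower p j hj
        rw [hl] at h2
        simp only at h1
        omega
  have ha1 := top a ha rfl
  have hheight : D.height a.2 = 0 := by
    refine Finset.sum_eq_zero fun p _ => ?_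
    by_contra hp
    have := D.coeff_del_lower p u a.1 a.2 hp
    rw [hdel, ha1, map_zero, zero_mul, zero_add, ← ha1] at this
    rcases mul_eq_zero.mp this.symm with h | h
    · exact hp (by exact_mod_cast h)
    · exact Finsupp.mem_support_iff.mp ha h
  have hsupp : u.coeff.support ⊆ {(0, 0)} := by
    intro b hb
    have hb2 : D.height b.2 = 0 := Nat.le_zero.mp (hheight ▸ hmax b hb)
    have hb1 := top b hb (hb2.trans hheight.symm)
    rw [Finset.mem_singleton]
    refine Prod.ext hb1 (Subtype.ext (funext fun p => ?_))
    exact (Finset.sum_eq_zero_iff.mp hb2) p (Finset.mem_univ _)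
  rw [Finsupp.support_subset_singleton] at hsupp
  refine Submodule.mem_span_singleton.mpr ⟨u.coeff (0, 0), ?_⟩
  refine AddMonoidAlgebra.coeff_injective ?_
  rw [hsupp, ← x_zero_zero, x]
  ext b
  simp

/-- Finite sets of exponents that are closed under lowering. -/
def IsLowerFinset (S : Finset (Γ × D.multiIdx)) : Prop :=
  ∀ a ∈ S, ∀ p, (a.1, D.lower p a.2) ∈ S

theorem exists_isLowerFinset (u : D.Alg) :
    ∃ S, D.IsLowerFinset S ∧ ∀ a ∉ S, u.coeff a = 0 := by
  classical
  have hfin : Set.Finite (⋃ a ∈ u.coeff.support,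
      {b : Γ × D.multiIdx | b.1 = a.1 ∧ b.2.1 ≤ a.2.1}) := by
    refine Set.Finite.biUnion (Finset.finite_toSet _) fun a _ => ?_
    have h1 : Set.Finite {i : D.multiIdx | i.1 ≤ a.2.1} :=
      (Set.finite_Iic a.2.1).preimage Subtype.val_injective.injOn
    refine ((Set.finite_singleton a.1).prod h1).subset ?_
    rintro ⟨b, i⟩ ⟨h, h'⟩
    exact ⟨h, h'⟩
  refine ⟨hfin.toFinset, ?_, ?_⟩
  · intro b hb p
    simp only [Set.Finite.mem_toFinset, Set.mem_iUnion, Set.mem_ofPred_eq] at hb ⊢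
    obtain ⟨a, ha, h1, h2⟩ := hb
    refine ⟨a, ha, h1, le_trans (fun q => ?_) h2⟩
    by_cases hq : q = p
    · subst hq; rw [lower_apply_self]; exact Nat.sub_le _ _
    · rw [D.lower_apply_ne p q _ hq]
  · intro a ha
    by_contra hc
    refine ha ?_
    simp only [Set.Finite.mem_toFinset, Set.mem_iUnion, Set.mem_ofPred_eq]
    exact ⟨a, Finsupp.mem_support_iff.mpr hc, rfl, le_rfl⟩

/-- Let `a = (α,i)` have maximal height in `S`. If `u` is not already an eigenvector for the weights
of `α`, then some `∂_p - φ_p(α)` or `diag β - φ(β,α)` sends it to a nonzero element of `V` supported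
on the lower set `S \ {a}`. -/
theorem exists_joint_eigenvector (V : Submodule F D.Alg)
    (hdel : ∀ p, ∀ u ∈ V, D.del p u ∈ V) (hdiag : ∀ β, ∀ u ∈ V, D.diag β u ∈ V)
    (S : Finset (Γ × D.multiIdx)) (hS : D.IsLowerFinset S) (u : D.Alg) (hu : u ∈ V)
    (hu0 : u ≠ 0) (huS : ∀ a ∉ S, u.coeff a = 0) :
    ∃ v ∈ V, v ≠ 0 ∧ ∃ α, (∀ p, D.del p v = D.weight p α • v) ∧
      ∀ β, D.diag β v = D.form β α • v := by
  classical
  induction S using Finset.strongInduction generalizing u with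
  | H S ih =>
    have hne : S.Nonempty := by
      by_contra h
      rw [Finset.not_nonempty_iff_eq_empty] at h
      subst h
      exact hu0 (AddMonoidAlgebra.coeff_eq_zero.mp (Finsupp.ext fun a => huS a (by simp)))
    obtain ⟨a, ha, hmax⟩ := Finset.exists_max_image S (fun a => D.height a.2) hne
    have nolower : ∀ b ∈ S, ∀ p, b.2.1 p ≠ 0 → (b.1, D.lower p b.2) ≠ a := by
      rintro b hb p hp rfl
      have h1 := hmax b hb
      have h2 := D.height_lower p b.2 hp
      simp only at h1
      omega
    have hT : D.IsLowerFinset (S.erase a) := by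
      intro b hb p
      obtain ⟨hba, hbS⟩ := Finset.mem_erase.mp hb
      refine Finset.mem_erase.mpr ⟨?_, hS b hbS p⟩
      by_cases hp : b.2.1 p = 0
      -- Lowering a zero entry changes nothing, by truncated subtraction.
      · have : D.lower p b.2 = b.2 := Subtype.ext (by
          simp only [lower, hp]
          rw [← hp.trans (Nat.zero_sub 1).symm, Function.update_eq_self])
        rwa [this]
      · exact nolower b hbS p hp
    have step : ∀ v ∈ V, v ≠ 0 → (∀ b ∉ S.erase a, v.coeff b = 0) → _ :=
      fun v hv hv0 hvS => ih _ (Finset.erase_ssubset ha) hT v hv hv0 hvS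
    by_cases hall : (∀ p, D.del p u = D.weight p a.1 • u) ∧
      ∀ β, D.diag β u = D.form β a.1 • u
    · exact ⟨u, hu, hu0, a.1, hall⟩
    rw [not_and_or] at hall
    push Not at hall
    rcases hall with ⟨p, hp⟩ | ⟨β, hβ⟩
    · refine step _ (V.sub_mem (hdel p u hu) (V.smul_mem _ hu)) (sub_ne_zero.mpr hp) ?_
      intro b hb
      rw [AddMonoidAlgebra.coeff_sub, AddMonoidAlgebra.coeff_smul, Finsupp.sub_apply,
        Finsupp.smul_apply, smul_eq_mul, D.coeff_del_of_top p u b.1 b.2]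
      · by_cases hba : b = a
        · rw [hba, sub_self]
        · rw [huS b fun h => hb (Finset.mem_erase.mpr ⟨hba, h⟩), mul_zero, mul_zero, sub_self]
      · intro j hj hl
        have hbl : b = (b.1, D.lower p j) := by rw [hl]
        refine huS _ fun hjS => hb ?_
        rw [hbl]
        exact Finset.mem_erase.mpr ⟨nolower _ hjS p hj, hS _ hjS p⟩
    · refine step _ (V.sub_mem (hdiag β u hu) (V.smul_mem _ hu)) (sub_ne_zero.mpr hβ) ?_
      intro b hb
      rw [AddMonoidAlgebra.coeff_sub, AddMonoidAlgebra.coeff_smul, Finsupp.sub_apply,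
        Finsupp.smul_apply, smul_eq_mul, coeff_diag]
      by_cases hba : b = a
      · rw [hba, sub_self]
      · rw [huS b fun h => hb (Finset.mem_erase.mpr ⟨hba, h⟩), mul_zero, mul_zero, sub_self]

end

/-! ### Recovering the derivations from the bracket; centre and Poisson ideals. -/

noncomputable section

variable {F Γ : Type*} [Field F] [AddCommGroup Γ] {m : ℕ} (D : TwistedHamiltonianData F Γ m)

/-- The other index of the pair to which `p` belongs. -/
def partner (p : Fin (m + 1) × Fin 2) : Fin (m + 1) × Fin 2 := (p.1, p.2.rev)

theorem partner_ne (p : Fin (m + 1) × Fin 2) : partner p ≠ p := by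
  obtain ⟨s, i⟩ := p
  fin_cases i <;> simp [partner]

/-- A function depending on the `q`-th direction only: the polynomial variable `x^{0,1_{[q]}}` when
`φ_q = 0`, and otherwise `x^{τ,0}` with the separating `τ` of condition (iii). -/
theorem exists_coordinate (q : Fin (m + 1) × Fin 2) :
    ∃ (b : D.Alg) (τ : Γ) (c : F), c ≠ 0 ∧ (∀ r, r ≠ q → D.weight r τ = 0) ∧
      D.del q b = c • D.x τ 0 ∧ (∀ r, r ≠ q → D.del r b = 0) ∧ ∀ u, D.formMul b u = 0 := by
  by_cases hq : D.weight q = 0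
  · have hJ := (D.J_eq q).resolve_left ((D.weight_or_J q).resolve_left (not_not.mpr hq))
    obtain ⟨j, hj, hl⟩ := D.exists_raise hJ 0
    have hj0 : j.1 q = 1 := by simpa using hj
    refine ⟨D.x 0 j, 0, 1, one_ne_zero, fun r _ => map_zero _, ?_, fun r hr => ?_, fun u => ?_⟩
    · simp [del_x, hl, hj0]
    · have : j.1 r = 0 := by rw [← D.lower_apply_ne q r j hr, hl]; rfl
      simp [del_x, this]
    · induction u using D.x_induction with
      | hadd u v hu hv => rw [map_add, hu, hv, add_zero]
      | hsmul c u hu => rw [map_smul, hu, smul_zero]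
      | hx α i => simp [formMul_x]
  · obtain ⟨τ, hτ, h0, h1⟩ := D.exists_separating q hq
    refine ⟨D.x τ 0, τ, D.weight q τ, h1, h0, D.del_x_zero q τ, fun r hr => ?_, fun u => ?_⟩
    · rw [del_x_zero, h0 r hr, zero_smul]
    · rw [formMul_skew, D.formMul_radical u τ hτ, neg_zero]

/-- Take `b` to be a coordinate in the direction paired with `p`: bracketing with it leaves only
`∂_p`, up to an invertible monomial. -/
theorem exists_pois_eq_del (p : Fin (m + 1) × Fin 2) :
    ∃ (b : D.Alg) (τ : Γ) (c : F), c ≠ 0 ∧ D.weight p τ = 0 ∧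
      ∀ w, D.pois b w = c • (D.x (τ + D.shift p.1) 0 * D.del p w) := by
  obtain ⟨b, τ, c, hc, hτ, hb, hb', hform⟩ := D.exists_coordinate (partner p)
  have hx : D.x (τ + D.shift p.1) 0 = D.x (D.shift p.1) 0 * D.x τ 0 := by
    rw [x_mul_x, add_comm, add_zero]
  obtain ⟨s, i⟩ := p
  have hne : ∀ t, t ≠ s → ∀ j, D.del (t, j) b = 0 :=
    fun t ht j => hb' _ fun h => ht (congrArg Prod.fst h)
  have hsum : ∀ w, D.pois b w = D.x (D.shift s) 0 *
      (D.del (s, 0) b * D.del (s, 1) w - D.del (s, 0) w * D.del (s, 1) b) := by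
    intro w
    rw [pois, hform, add_zero, Finset.sum_eq_single s]
    · intro t _ ht
      rw [hne t ht, hne t ht, zero_mul, mul_zero, sub_zero, mul_zero]
    · simp
  have hτ' := hτ _ (partner_ne (s, i)).symm
  have hb'' := hb' _ (partner_ne (s, i)).symm
  fin_cases i
  · refine ⟨b, τ, -c, neg_ne_zero.mpr hc, hτ', fun w => ?_⟩
    have h1 : D.del (s, 1) b = c • D.x τ 0 := hb
    have h2 : D.del (s, 0) b = 0 := hb''
    rw [hsum, h1, h2, hx, zero_mul, zero_sub, mul_smul_comm, mul_neg, mul_smul_comm, neg_smul]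
    congr 2
    simp only [Fin.zero_eta]
    ring
  · refine ⟨b, τ, c, hc, hτ', fun w => ?_⟩
    have h1 : D.del (s, 0) b = c • D.x τ 0 := hb
    have h2 : D.del (s, 1) b = 0 := hb''
    rw [hsum, h1, h2, hx, mul_zero, sub_zero, smul_mul_assoc, mul_smul_comm]
    congr 1
    simp only [Fin.mk_one]
    ring

theorem exists_del_eq (p : Fin (m + 1) × Fin 2) :
    ∃ (b : D.Alg) (e : D.Alg), ∀ w, D.del p w = e * D.pois b w := by
  obtain ⟨b, τ, c, hc, -, h⟩ := D.exists_pois_eq_del p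
  refine ⟨b, c⁻¹ • D.x (-(τ + D.shift p.1)) 0, fun w => ?_⟩
  rw [h, smul_mul_smul_comm, inv_mul_cancel₀ hc, one_smul, ← mul_assoc, x_neg_mul_x, one_mul]

theorem formMul_eq_pois_sub (u w : D.Alg) : D.formMul u w = D.pois u w - ∑ s, D.x (D.shift s) 0 *
    (D.del (s, 0) u * D.del (s, 1) w - D.del (s, 0) w * D.del (s, 1) u) := by
  rw [pois]; ring

theorem exists_J_eq_top (h : D.multiIdx ≠ ⊥) : ∃ p, D.J p = ⊤ := by
  by_contra hc
  push Not at hc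
  refine h ((AddSubmonoid.eq_bot_iff_forall _).mpr fun i hi => funext fun p => ?_)
  have := (D.mem_multiIdx i).mp hi p
  rwa [(D.J_eq p).resolve_right (hc p), AddSubmonoid.mem_bot] at this

/-- The sum of the exponents of the structure coefficients. -/
def shiftSum : Γ := ∑ s, D.shift s

theorem shiftSum_mem : D.shiftSum ∈ D.form.ker := sum_mem fun s _ => D.shift_mem s

theorem weight_shiftSum (p : Fin (m + 1) × Fin 2) :
    D.weight p D.shiftSum = D.weight p (D.shift p.1) := by
  rw [shiftSum, map_sum, Finset.sum_eq_single p.1]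
  · exact fun s _ hs => D.weight_shift s p hs.symm
  · simp

theorem shiftSum_ne_zero : D.shiftSum ≠ 0 := by
  intro h
  have := D.weight_shiftSum (0, 0)
  simp [h, shift, D.weight_zero_ε] at this

theorem shiftSum_sub_ε : -D.ε + D.shiftSum = D.sigma := by
  rw [shiftSum, Fin.sum_univ_succ, sigma]
  simp only [shift, Fin.cases_zero, Fin.cases_succ]
  abel

/-- The coefficient of `x^{α,0}` as a linear form. -/
def coeffHom (α : Γ) : D.Alg →ₗ[F] F := D.xBasis.coord (α, 0)

theorem coeffHom_x (α β : Γ) [Decidable (β = α)] :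
    D.coeffHom α (D.x β 0) = if β = α then 1 else 0 := by
  classical
  rw [coeffHom, Module.Basis.coord_apply, ← D.xBasis_apply (β, 0), Module.Basis.repr_self,
    Finsupp.single_apply]
  simp [Prod.mk.injEq]

variable [CharZero F]

theorem centralConst : D.poisson.CentralConst := by
  intro u hu
  have hu' : ∀ b, D.pois b u = 0 := fun b => by
    rw [pois_skew, neg_eq_zero]; exact hu b
  have hdel : ∀ p, D.del p u = 0 := fun p => by
    obtain ⟨b, e, h⟩ := D.exists_del_eq p
    rw [h, hu', mul_zero]
  refine D.mem_span_one u hdel fun β => ?_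
  rw [diag, formMul_eq_pois_sub, hu']
  simp [hdel]

/-- A nonzero Poisson ideal contains a joint eigenvector `v` with the weights of some `α`. Then
`x^{-α,0} v` has all weights zero, so it is a nonzero constant in the ideal. -/
theorem isPoissonSimple : D.poisson.IsPoissonSimple := by
  intro I hI
  by_cases hbot : I = ⊥
  · exact Or.inl hbot
  right
  obtain ⟨u, huI, hu0⟩ := Submodule.exists_mem_ne_zero_of_ne_bot hbot
  have hdel : ∀ p, ∀ u ∈ I, D.del p u ∈ I := fun p u hu => by
    obtain ⟨b, e, h⟩ := D.exists_del_eq p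
    rw [h]
    exact I.mul_mem_left _ (hI b u hu)
  have hdiag : ∀ β, ∀ u ∈ I, D.diag β u ∈ I := fun β u hu => by
    rw [diag, formMul_eq_pois_sub]
    refine I.mul_mem_left _ (I.sub_mem (hI _ u hu) (I.sum_mem fun s _ => I.mul_mem_left _ ?_))
    exact I.sub_mem (I.mul_mem_left _ (hdel _ u hu)) (I.mul_mem_right _ (hdel _ u hu))
  obtain ⟨S, hS, huS⟩ := D.exists_isLowerFinset u
  obtain ⟨v, hvI, hv0, α, hv, hv'⟩ := D.exists_joint_eigenvector (I.restrictScalars F) hdel hdiag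
    S hS u huI hu0 huS
  have hw : D.x (-α) 0 * v ∈ Submodule.span F {(1 : D.Alg)} := by
    refine D.mem_span_one _ (fun p => ?_) fun β => ?_
    · rw [del_leibniz, hv, del_x_zero, map_neg, neg_smul, mul_smul_comm, mul_neg, mul_smul_comm,
        mul_comm v, add_neg_cancel]
    · rw [diag_mul, hv', diag_x, map_neg, neg_smul, mul_smul_comm, mul_neg, mul_smul_comm,
        mul_comm v, add_neg_cancel]
  obtain ⟨c, hc⟩ := Submodule.mem_span_singleton.mp hw
  have hc0 : c ≠ 0 := by
    rintro rfl
    apply hv0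
    rw [← one_mul v, ← D.x_mul_x_neg α, mul_assoc, ← hc, zero_smul, mul_zero]
  refine (Ideal.eq_top_iff_one _).mpr ?_
  have h1 : c • (1 : D.Alg) ∈ I.restrictScalars F := by
    rw [hc]; exact I.mul_mem_left _ hvI
  have h2 := (I.restrictScalars F).smul_mem c⁻¹ h1
  rwa [smul_smul, inv_mul_cancel₀ hc0, one_smul] at h2

/-! ### The span of all brackets. -/

theorem x_shift_mul_del_mem (p : Fin (m + 1) × Fin 2) (w : D.Alg) :
    D.x (D.shift p.1) 0 * D.del p w ∈ D.poisson.derived := by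
  obtain ⟨b, τ, c, hc, hτ, h⟩ := D.exists_pois_eq_del p
  have hmem := D.poisson.derived.smul_mem c⁻¹ (D.poisson.mem_derived b (D.x (-τ) 0 * w))
  rw [poisson_apply, h, smul_smul, inv_mul_cancel₀ hc, one_smul, del_leibniz, del_x_zero,
    map_neg, hτ, neg_zero, zero_smul, mul_zero, add_zero, ← mul_assoc, x_mul_x] at hmem
  simpa using hmem

/-- If `φ_p(α) = 0`, integrate in the `p`-th variable, which needs characteristic 0. Otherwise `∂_p`
is a nonzero scalar plus a lowering operator, inverted by induction on `i_p`. -/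
theorem x_mem_range_del {p : Fin (m + 1) × Fin 2} (hp : D.J p = ⊤) (α : Γ) (i : D.multiIdx) :
    D.x α i ∈ LinearMap.range (D.del p) := by
  by_cases hα : D.weight p α = 0
  · obtain ⟨j, hj, hl⟩ := D.exists_raise hp i
    refine ⟨((j.1 p : F))⁻¹ • D.x α j, ?_⟩
    have hj0 : (j.1 p : F) ≠ 0 := by rw [hj]; exact Nat.cast_ne_zero.mpr (Nat.succ_ne_zero _)
    rw [map_smul, del_x, hα, zero_smul, zero_add, hl, smul_smul, inv_mul_cancel₀ hj0, one_smul]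
  · generalize hk : i.1 p = k
    induction k generalizing i with
    | zero =>
      refine ⟨(D.weight p α)⁻¹ • D.x α i, ?_⟩
      rw [map_smul, del_x, hk, Nat.cast_zero, zero_smul, add_zero, smul_smul,
        inv_mul_cancel₀ hα, one_smul]
    | succ k ih =>
      have h1 := ih (D.lower p i) (by rw [lower_apply_self]; omega)
      have e : D.x α i = (D.weight p α)⁻¹ •
          (D.del p (D.x α i) - (i.1 p : F) • D.x α (D.lower p i)) := by
        rw [del_x, add_sub_cancel_right, smul_smul, inv_mul_cancel₀ hα, one_smul]
      rw [e]
      exact Submodule.smul_mem _ _ (Submodule.sub_mem _ ⟨_, rfl⟩ (Submodule.smul_mem _ _ h1))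

theorem derived_eq_top (h : D.multiIdx ≠ ⊥) : D.poisson.derived = ⊤ := by
  obtain ⟨p, hp⟩ := D.exists_J_eq_top h
  refine eq_top_iff.mpr fun u _ => ?_
  induction u using D.x_induction with
  | hadd u v hu hv => exact Submodule.add_mem _ (hu trivial) (hv trivial)
  | hsmul c u hu => exact Submodule.smul_mem _ _ (hu trivial)
  | hx α i =>
    obtain ⟨w, hw⟩ := D.x_mem_range_del hp (α - D.shift p.1) i
    have := D.x_shift_mul_del_mem p w
    rw [hw, x_mul_x] at this
    simpa using this

theorem x_mem_derived_of_weight_ne {γ : Γ} {p : Fin (m + 1) × Fin 2}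
    (h : D.weight p (γ - D.shift p.1) ≠ 0) : D.x γ 0 ∈ D.poisson.derived := by
  have := D.poisson.derived.smul_mem (D.weight p (γ - D.shift p.1))⁻¹
    (D.x_shift_mul_del_mem p (D.x (γ - D.shift p.1) 0))
  rw [del_x_zero, mul_smul_comm, smul_smul, inv_mul_cancel₀ h, one_smul, x_mul_x] at this
  simpa using this

/-- If no `∂_p` produces `x^{γ,0}`, then `γ` and `shiftSum` have equal weights, so `γ ≠ shiftSum`
forces `φ(β,γ) ≠ 0` for some `β`. The form part of `{x^{β,0}, x^{γ-β,0}}` is then a nonzero multiple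
of `x^{γ,0}`. -/
theorem x_mem_derived {γ : Γ} (hγ : γ ≠ D.shiftSum) : D.x γ 0 ∈ D.poisson.derived := by
  by_cases hp : ∃ p : Fin (m + 1) × Fin 2, D.weight p (γ - D.shift p.1) ≠ 0
  · obtain ⟨p, hp⟩ := hp
    exact D.x_mem_derived_of_weight_ne hp
  push Not at hp
  have hβ : ∃ β, D.form β γ ≠ 0 := by
    by_contra hβ
    push Not at hβ
    refine hγ (sub_eq_zero.mp (D.eq_zero_of_weights _ (fun β => ?_) fun p => ?_))
    · have h0 : D.form D.shiftSum = 0 := D.shiftSum_mem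
      rw [map_sub, hβ, D.form_skew, h0]
      simp
    · rw [map_sub, weight_shiftSum, ← map_sub, hp]
  obtain ⟨β, hβ⟩ := hβ
  have h := D.poisson.mem_derived (D.x β 0) (D.x (γ - β) 0)
  have hself : D.form β β = 0 := by
    have h := D.form_skew β β
    rw [eq_neg_iff_add_eq_zero, ← two_smul F] at h
    exact (smul_eq_zero.mp h).resolve_left two_ne_zero
  have hform : D.formMul (D.x β 0) (D.x (γ - β) 0) = D.form β γ • D.x γ 0 := by
    rw [formMul_x, x_mul_x, map_sub, hself, sub_zero]
    simp
  -- The remaining terms are multiples of `x^{shift s + γ,0}`. Each is either covered by the weight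
  -- case, since some weight of `γ` in the pair `s` is nonzero, or has coefficient zero.
  have hsum : (∑ s, D.x (D.shift s) 0 * (D.del (s, 0) (D.x β 0) * D.del (s, 1) (D.x (γ - β) 0)
      - D.del (s, 0) (D.x (γ - β) 0) * D.del (s, 1) (D.x β 0))) ∈ D.poisson.derived := by
    refine Submodule.sum_mem _ fun s _ => ?_
    have e : D.x (D.shift s) 0 * (D.del (s, 0) (D.x β 0) * D.del (s, 1) (D.x (γ - β) 0)
        - D.del (s, 0) (D.x (γ - β) 0) * D.del (s, 1) (D.x β 0))
        = (D.weight (s, 0) β * D.weight (s, 1) γ - D.weight (s, 0) γ * D.weight (s, 1) β) •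
          D.x (D.shift s + γ) 0 := by
      have h1 : D.x β 0 * D.x (γ - β) 0 = D.x γ 0 := by rw [x_mul_x]; simp
      have h2 : D.x (γ - β) 0 * D.x β 0 = D.x γ 0 := by rw [x_mul_x]; simp
      rw [del_x_zero, del_x_zero, del_x_zero, del_x_zero, smul_mul_smul_comm, smul_mul_smul_comm,
        h1, h2, ← sub_smul, mul_smul_comm, x_mul_x, add_zero, map_sub, map_sub]
      congr 1; ring
    rw [e]
    by_cases h0 : ∃ i, D.weight (s, i) γ ≠ 0
    · obtain ⟨i, hi⟩ := h0
      refine Submodule.smul_mem _ _ (D.x_mem_derived_of_weight_ne (p := (s, i)) ?_)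
      rwa [add_sub_cancel_left]
    · push Not at h0
      rw [h0, h0, mul_zero, zero_mul, sub_zero, zero_smul]
      exact zero_mem _
  rw [poisson_apply, pois, hform] at h
  have h2 := (Submodule.add_mem_iff_right _ hsum).mp h
  have h3 := D.poisson.derived.smul_mem (D.form β γ)⁻¹ h2
  rwa [smul_smul, inv_mul_cancel₀ hβ, one_smul] at h3

end

/-! ### The group algebra case `𝒥 = 0`. -/

noncomputable section

variable {F Γ : Type*} [Field F] [AddCommGroup Γ] {m : ℕ} (D : TwistedHamiltonianData F Γ m)

theorem eq_zero_of_multiIdx_eq_bot (hJ : D.multiIdx = ⊥) (i : D.multiIdx) : i = 0 := by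
  have h : i.1 ∈ (⊥ : AddSubmonoid _) := hJ.le i.2
  exact Subtype.ext (AddSubmonoid.mem_bot.mp h)

theorem x_zero_induction (hJ : D.multiIdx = ⊥) {P : D.Alg → Prop} (hx : ∀ α, P (D.x α 0))
    (hadd : ∀ u v, P u → P v → P (u + v)) (hsmul : ∀ (c : F) u, P u → P (c • u)) (u : D.Alg) :
    P u :=
  D.x_induction (fun α i => by rw [D.eq_zero_of_multiIdx_eq_bot hJ i]; exact hx α) hadd hsmul u

theorem x_pow (α : Γ) (n : ℕ) : D.x α 0 ^ n = D.x (n • α) 0 := by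
  induction n with
  | zero => rw [pow_zero, zero_smul, x_zero_zero]
  | succ n ih => rw [pow_succ, ih, x_mul_x, add_zero, succ_nsmul]

/-- The isomorphism from `𝒜` with the Poisson bracket onto `𝒜` with the bracket `br`. -/
def shiftEquiv : D.Alg ≃ₗ[F] D.LieAlg :=
  LinearEquiv.ofLinearMap (LinearMap.mulLeft F (D.x (-D.ε) 0)) (LinearMap.mulLeft F (D.x D.ε 0))
    (LinearMap.ext fun u => by simp [← mul_assoc, x_neg_mul_x])
    (LinearMap.ext fun u => by simp [← mul_assoc, x_mul_x_neg])
    ≪≫ₗ D.toLie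

theorem shiftEquiv_apply (u : D.Alg) : D.shiftEquiv u = D.toLie (D.x (-D.ε) 0 * u) := rfl

variable [CharZero F]

/-- If `α + β = shiftSum` is radical, then `φ(α,β) = φ(α,α+β) = 0`. If `shift s + α + β = shiftSum`,
the weights of `β` in the pair `s` are minus those of `α`, and the 2×2 determinant vanishes. -/
theorem coeffHom_pois (hJ : D.multiIdx = ⊥) (u w : D.Alg) :
    D.coeffHom D.shiftSum (D.pois u w) = 0 := by
  classical
  change D.coeffHom D.shiftSum (D.poisson u w) = 0
  induction u using D.x_zero_induction hJ with
  | hadd u v hu hv => rw [PoissonBracket.add_left, map_add, hu, hv, add_zero]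
  | hsmul c u hu => rw [map_smul, LinearMap.smul_apply, map_smul, hu, smul_zero]
  | hx α =>
    induction w using D.x_zero_induction hJ with
    | hadd u v hu hv => rw [map_add, map_add, hu, hv, add_zero]
    | hsmul c u hu => rw [map_smul, map_smul, hu, smul_zero]
    | hx β =>
      rw [poisson_apply, pois, map_add, map_sum]
      have hform : D.coeffHom D.shiftSum (D.formMul (D.x α 0) (D.x β 0)) = 0 := by
        rw [formMul_x, x_mul_x, add_zero, map_smul, coeffHom_x]
        split_ifs with h
        · have hself : D.form α α = 0 := by
            have h := D.form_skew α α
            rw [eq_neg_iff_add_eq_zero, ← two_smul F] at h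
            exact (smul_eq_zero.mp h).resolve_left two_ne_zero
          have h0 : D.form D.shiftSum = 0 := D.shiftSum_mem
          have h1 : D.form α (α + β) = 0 := by rw [h, D.form_skew, h0]; simp
          rw [map_add, hself, zero_add] at h1
          rw [h1, zero_smul]
        · rw [smul_zero]
      rw [hform, add_zero]
      refine Finset.sum_eq_zero fun s _ => ?_
      have e : D.x (D.shift s) 0 * (D.del (s, 0) (D.x α 0) * D.del (s, 1) (D.x β 0)
          - D.del (s, 0) (D.x β 0) * D.del (s, 1) (D.x α 0))
          = (D.weight (s, 0) α * D.weight (s, 1) β - D.weight (s, 0) β * D.weight (s, 1) α) •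
            D.x (D.shift s + (α + β)) 0 := by
        rw [del_x_zero, del_x_zero, del_x_zero, del_x_zero, smul_mul_smul_comm,
          smul_mul_smul_comm, mul_comm (D.x β 0), ← sub_smul, mul_smul_comm, x_mul_x, x_mul_x,
          add_zero, add_zero]
      rw [e, map_smul, coeffHom_x]
      split_ifs with h
      · have h1 : ∀ i, D.weight (s, i) β = -D.weight (s, i) α := by
          intro i
          have h1 := congrArg (D.weight (s, i)) h
          rw [weight_shiftSum, map_add, map_add] at h1
          linear_combination h1
        rw [h1, h1, smul_eq_mul, mul_one]
        ring
      · rw [smul_zero]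

theorem mem_derived_iff (hJ : D.multiIdx = ⊥) (u : D.Alg) :
    u ∈ D.poisson.derived ↔ D.coeffHom D.shiftSum u = 0 := by
  classical
  constructor
  · intro hu
    have : D.poisson.derived ≤ LinearMap.ker (D.coeffHom D.shiftSum) := by
      refine Submodule.span_le.mpr ?_
      rintro _ ⟨a, b, rfl⟩
      exact D.coeffHom_pois hJ a b
    exact this hu
  · intro hu
    have key : ∀ v, v - D.coeffHom D.shiftSum v • D.x D.shiftSum 0 ∈ D.poisson.derived := by
      intro v
      induction v using D.x_zero_induction hJ with
      | hadd u v hu hv =>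
        rw [map_add, add_smul, add_sub_add_comm]
        exact add_mem hu hv
      | hsmul c u hu =>
        rw [map_smul, smul_assoc, ← smul_sub]
        exact Submodule.smul_mem _ _ hu
      | hx α =>
        rw [coeffHom_x]
        split_ifs with h
        · rw [h, one_smul, sub_self]; exact zero_mem _
        · rw [zero_smul, sub_zero]; exact D.x_mem_derived h
    simpa [hu] using key u

theorem one_mem_derived : (1 : D.Alg) ∈ D.poisson.derived :=
  D.x_mem_derived D.shiftSum_ne_zero.symm

/-- A monomial `x^{α,0}` is a good generator unless `kα = shiftSum` for some `k ∈ {1,2,3}`; the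
exceptions are products of two good ones. -/
theorem adjoin_powersIn_derived [IsAddTorsionFree Γ] (hJ : D.multiIdx = ⊥) :
    Algebra.adjoin F (PoissonBracket.powersIn D.poisson.derived) = ⊤ := by
  have base : ∀ α, α ≠ D.shiftSum → 2 • α ≠ D.shiftSum → 3 • α ≠ D.shiftSum →
      D.x α 0 ∈ Algebra.adjoin F (PoissonBracket.powersIn D.poisson.derived) := by
    intro α h1 h2 h3
    refine Algebra.subset_adjoin ⟨D.x_mem_derived h1, ?_, ?_⟩
    · rw [x_pow]; exact D.x_mem_derived h2
    · rw [x_pow]; exact D.x_mem_derived h3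
  have hmul : ∀ k : ℤ, 1 ≤ k → k ≤ 3 → ∀ α, k • α = D.shiftSum →
      D.x α 0 ∈ Algebra.adjoin F (PoissonBracket.powersIn D.poisson.derived) := by
    intro k hk hk' α hα
    have hα0 : α ≠ 0 := by
      rintro rfl
      exact D.shiftSum_ne_zero (by rw [← hα, smul_zero])
    have hne : ∀ l : ℤ, l ≠ k → l • α ≠ D.shiftSum := by
      intro l hl h
      rw [← hα] at h
      exact hl (smul_left_injective ℤ hα0 h)
    -- By torsion-freeness only `kα` equals `shiftSum`. The first three multiples of `4α` and `-3α`
    -- are `lα` with `l ≥ 4` or `l < 0`, so never `l = k`.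
    have e : D.x α 0 = D.x ((4 : ℤ) • α) 0 * D.x ((-3 : ℤ) • α) 0 := by
      rw [x_mul_x, add_zero, ← add_smul]; norm_num
    have hnat : ∀ (n : ℕ) (l : ℤ), n * l ≠ k → n • l • α ≠ D.shiftSum := by
      intro n l h
      rw [← natCast_zsmul, smul_smul]
      exact hne _ h
    rw [e]
    refine mul_mem (base _ ?_ ?_ ?_) (base _ ?_ ?_ ?_)
    · exact hne _ (by omega)
    · exact hnat 2 4 (by norm_num; omega)
    · exact hnat 3 4 (by norm_num; omega)
    · exact hne _ (by omega)
    · exact hnat 2 (-3) (by norm_num; omega)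
    · exact hnat 3 (-3) (by norm_num; omega)
  refine eq_top_iff.mpr fun u _ => ?_
  induction u using D.x_zero_induction hJ with
  | hadd u v hu hv => exact add_mem (hu trivial) (hv trivial)
  | hsmul c u hu => exact Subalgebra.smul_mem _ (hu trivial) c
  | hx α =>
    by_cases h1 : α = D.shiftSum
    · exact hmul 1 le_rfl (by norm_num) α (by rw [one_smul, h1])
    by_cases h2 : 2 • α = D.shiftSum
    · exact hmul 2 (by norm_num) (by norm_num) α (by rw [← h2]; exact natCast_zsmul α 2)
    by_cases h3 : 3 • α = D.shiftSum
    · exact hmul 3 (by norm_num) le_rfl α (by rw [← h3]; exact natCast_zsmul α 3)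
    exact base α h1 h2 h3

theorem x_notMem_span_one {α : Γ} (hα : α ≠ 0) :
    D.x α 0 ∉ Submodule.span F {(1 : D.Alg)} := by
  classical
  intro h
  obtain ⟨c, hc⟩ := Submodule.mem_span_singleton.mp h
  have h1 := congrArg (D.coeffHom α) hc
  rw [map_smul, ← x_zero_zero, coeffHom_x, coeffHom_x, if_neg hα.symm, if_pos rfl] at h1
  simp at h1

/-- The witness is `x^{2ρ,0}` with `ρ = shiftSum`: as `ρ ≠ 0`, the exponent `2ρ` is neither `ρ` nor
0. -/
theorem not_derived_le_span_one [IsAddTorsionFree Γ] :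
    ¬ D.poisson.derived ≤ Submodule.span F {(1 : D.Alg)} := by
  intro h
  have h0 := D.shiftSum_ne_zero
  have h2 : 2 • D.shiftSum ≠ 0 := fun h => h0 ((nsmul_eq_zero_iff_right two_ne_zero).mp h)
  refine D.x_notMem_span_one h2 (h (D.x_mem_derived fun e => h0 ?_))
  rwa [two_nsmul, add_eq_left] at e

/-! ### Descent to the quotient `ℋ`. -/

theorem lie_shiftEquiv (u w : D.Alg) :
    ⁅D.shiftEquiv u, D.shiftEquiv w⁆ = D.shiftEquiv (D.poisson u w) := by
  rw [shiftEquiv_apply, shiftEquiv_apply, toLie_lie, br_shift]; rfl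

/-- The projection of `𝒜`, with the Poisson bracket, onto `ℋ`. -/
def proj : D.Alg →ₗ[F] D.TwistedHamiltonian :=
  (LieSubmodule.Quotient.mk' D.centralLine : D.LieAlg →ₗ[F] D.TwistedHamiltonian) ∘ₗ
    D.shiftEquiv.toLinearMap

theorem proj_surjective : Function.Surjective D.proj :=
  (LieSubmodule.Quotient.surjective_mk' D.centralLine).comp D.shiftEquiv.surjective

theorem lie_proj (u w : D.Alg) : ⁅D.proj u, D.proj w⁆ = D.proj (D.poisson u w) := by
  change ⁅_, _⁆ = LieSubmodule.Quotient.mk' D.centralLine (D.shiftEquiv (D.poisson u w))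
  rw [← lie_shiftEquiv]
  rfl

theorem proj_eq_zero_iff (u : D.Alg) : D.proj u = 0 ↔ u ∈ Submodule.span F {(1 : D.Alg)} := by
  have h1 : D.proj u = 0 ↔ D.shiftEquiv u ∈ D.centralLine :=
    LieSubmodule.Quotient.mk_eq_zero'
  have h2 : D.shiftEquiv u ∈ D.centralLine ↔
      D.shiftEquiv u ∈ Submodule.span F {D.xLie (-D.ε) 0} := Iff.rfl
  rw [h1, h2, Submodule.mem_span_singleton, Submodule.mem_span_singleton]
  have h3 : D.xLie (-D.ε) 0 = D.shiftEquiv 1 := by rw [shiftEquiv_apply, mul_one]; rfl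
  refine exists_congr fun c => ?_
  rw [h3, ← map_smul, D.shiftEquiv.injective.eq_iff]

theorem derivedAlg_toSubmodule :
    D.derivedAlg.toSubmodule = D.poisson.derived.map D.proj := by
  rw [LieSubmodule.lieIdeal_oper_eq_linear_span, PoissonBracket.derived, Submodule.map_span]
  congr 1
  ext y
  constructor
  · rintro ⟨⟨a, -⟩, ⟨b, -⟩, rfl⟩
    obtain ⟨u, rfl⟩ := D.proj_surjective a
    obtain ⟨w, rfl⟩ := D.proj_surjective b
    exact ⟨_, ⟨u, w, rfl⟩, (D.lie_proj u w).symm⟩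
  · rintro ⟨_, ⟨u, w, rfl⟩, rfl⟩
    exact ⟨⟨D.proj u, trivial⟩, ⟨D.proj w, trivial⟩, D.lie_proj u w⟩

/-- The nontrivial direction needs the kernel `F·1` of `proj` to lie in `{𝒜,𝒜}`, which holds because
`shiftSum ≠ 0`. -/
theorem proj_mem_derivedAlg_iff (u : D.Alg) :
    D.proj u ∈ D.derivedAlg ↔ u ∈ D.poisson.derived := by
  rw [← LieSubmodule.mem_toSubmodule, derivedAlg_toSubmodule]
  constructor
  · rintro ⟨w, hw, h⟩
    have h1 : u - w ∈ Submodule.span F {(1 : D.Alg)} := by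
      rw [← proj_eq_zero_iff, map_sub, h, sub_self]
    have h2 : u - w ∈ D.poisson.derived :=
      (Submodule.span_singleton_le_iff_mem _ _).mpr D.one_mem_derived h1
    simpa using add_mem h2 hw
  · exact fun hu => ⟨u, hu, rfl⟩

theorem sigmaLine_eq : D.sigmaLine = Submodule.span F {D.proj (D.x D.shiftSum 0)} := by
  have h1 : D.xLie D.sigma 0 = D.shiftEquiv (D.x D.shiftSum 0) := by
    rw [shiftEquiv_apply, x_mul_x, shiftSum_sub_ε, add_zero]; rfl
  have h2 : D.xLie (-D.ε) 0 = D.shiftEquiv 1 := by rw [shiftEquiv_apply, mul_one]; rfl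
  have h3 : D.proj 1 = 0 := (D.proj_eq_zero_iff 1).mpr (Submodule.mem_span_singleton_self 1)
  rw [sigmaLine, Submodule.map_sup, Submodule.map_span, Submodule.map_span,
    Set.image_singleton, Set.image_singleton, h1, h2]
  change Submodule.span F {D.proj (D.x D.shiftSum 0)} ⊔ Submodule.span F {D.proj 1} = _
  rw [h3, Submodule.span_zero_singleton, sup_bot_eq]

theorem isCompl_derivedAlg_sigmaLine (hJ : D.multiIdx = ⊥) :
    IsCompl D.derivedAlg.toSubmodule D.sigmaLine := by
  classical
  have hself : D.coeffHom D.shiftSum (D.x D.shiftSum 0) = 1 := by rw [coeffHom_x, if_pos rfl]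
  rw [sigmaLine_eq]
  constructor
  · rw [Submodule.disjoint_def]
    intro y hy hy'
    obtain ⟨c, rfl⟩ := Submodule.mem_span_singleton.mp hy'
    rw [← map_smul, LieSubmodule.mem_toSubmodule, proj_mem_derivedAlg_iff, D.mem_derived_iff hJ,
      map_smul, hself, smul_eq_mul, mul_one] at hy
    rw [hy, zero_smul]
  · rw [codisjoint_iff, eq_top_iff]
    intro y _
    obtain ⟨u, rfl⟩ := D.proj_surjective y
    refine Submodule.mem_sup.mpr
      ⟨D.proj (u - D.coeffHom D.shiftSum u • D.x D.shiftSum 0), ?_,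
        D.coeffHom D.shiftSum u • D.proj (D.x D.shiftSum 0),
        Submodule.smul_mem _ _ (Submodule.mem_span_singleton_self _), ?_⟩
    · rw [LieSubmodule.mem_toSubmodule, proj_mem_derivedAlg_iff, D.mem_derived_iff hJ, map_sub,
        map_smul, hself, smul_eq_mul, mul_one, sub_self]
    · rw [map_sub, map_smul, sub_add_cancel]

theorem isSimple_of_multiIdx_ne_bot [IsAddTorsionFree Γ] (hJ : D.multiIdx ≠ ⊥) :
    LieAlgebra.IsSimple F D.TwistedHamiltonian := by
  have := D.alg_noZeroDivisors
  have htop := D.derived_eq_top hJ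
  have hK : Algebra.adjoin F (PoissonBracket.powersIn (⊤ : Submodule F D.Alg)) = ⊤ :=
    eq_top_iff.mpr fun u _ => Algebra.subset_adjoin ⟨trivial, trivial, trivial⟩
  refine ⟨fun I => ?_, fun hab => ?_⟩
  · have hM : D.poisson.Stable ⊤ (I.toSubmodule.comap D.proj) := by
      intro d _ u hu
      change D.proj _ ∈ I
      rw [← lie_proj]
      exact lie_mem_right F _ I _ _ hu
    rcases hM.le_const_or_derived_le D.centralConst D.isPoissonSimple hK le_top le_top with h | h
    · left
      refine (LieSubmodule.eq_bot_iff _).mpr fun y hy => ?_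
      obtain ⟨u, rfl⟩ := D.proj_surjective y
      exact (D.proj_eq_zero_iff u).mpr (h hy)
    · right
      refine eq_top_iff.mpr fun y _ => ?_
      obtain ⟨u, rfl⟩ := D.proj_surjective y
      rw [htop] at h
      exact h (x := u) trivial
  -- If `ℋ` were abelian, every Poisson bracket would be constant.
  · refine D.not_derived_le_span_one (Submodule.span_le.mpr ?_)
    rintro _ ⟨a, b, rfl⟩
    change D.poisson a b ∈ Submodule.span F {(1 : D.Alg)}
    rw [← proj_eq_zero_iff, ← lie_proj]
    exact hab.trivial _ _

theorem isSimple_derivedAlg [IsAddTorsionFree Γ] (hJ : D.multiIdx = ⊥) :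
    LieAlgebra.IsSimple F D.derivedAlg := by
  have := D.alg_noZeroDivisors
  have hK := D.adjoin_powersIn_derived hJ
  refine ⟨fun I => ?_, fun hab => ?_⟩
  -- Pull the ideal of `ℋ^{(1)}` back to `𝒜`; it is stable under `{𝒜,𝒜}` only, hence the Herstein
  -- argument with `K = {𝒜,𝒜}`.
  · set M : Submodule F D.Alg :=
      (I.toSubmodule.map D.derivedAlg.toSubmodule.subtype).comap D.proj
    have hmem : ∀ u, u ∈ M ↔
        ∃ h : D.proj u ∈ D.derivedAlg, (⟨D.proj u, h⟩ : D.derivedAlg) ∈ I := by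
      intro u
      constructor
      · rintro ⟨y, hy, hyu⟩
        have h : D.proj u ∈ D.derivedAlg := hyu ▸ y.2
        refine ⟨h, ?_⟩
        have : y = ⟨D.proj u, h⟩ := Subtype.ext hyu
        rwa [← this]
      · rintro ⟨h, hI⟩
        exact ⟨_, hI, rfl⟩
    have hMK : M ≤ D.poisson.derived := fun u hu =>
      (D.proj_mem_derivedAlg_iff u).mp ((hmem u).mp hu).1
    have hM : D.poisson.Stable D.poisson.derived M := by
      intro d hd u hu
      obtain ⟨h, hI⟩ := (hmem u).mp hu
      have hd' := (D.proj_mem_derivedAlg_iff d).mpr hd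
      have h2 := lie_mem_right F _ I (⟨D.proj d, hd'⟩ : D.derivedAlg) _ hI
      exact ⟨_, h2, D.lie_proj d u⟩
    rcases hM.le_const_or_derived_le D.centralConst D.isPoissonSimple hK le_rfl hMK with h | h
    · left
      refine (LieSubmodule.eq_bot_iff _).mpr ?_
      rintro ⟨y, hyd⟩ hy
      obtain ⟨u, rfl⟩ := D.proj_surjective y
      exact Subtype.ext ((D.proj_eq_zero_iff u).mpr (h ((hmem u).mpr ⟨hyd, hy⟩)))
    · right
      refine eq_top_iff.mpr ?_
      rintro ⟨y, hyd⟩ _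
      obtain ⟨u, rfl⟩ := D.proj_surjective y
      exact ((hmem u).mp (h ((D.proj_mem_derivedAlg_iff u).mp hyd))).2
  -- Were `ℋ^{(1)}` abelian, brackets within `{𝒜,𝒜}` would be constant, so `{𝒜,𝒜}` itself would
  -- consist of constants.
  · refine D.not_derived_le_span_one ?_
    have hst : D.poisson.Stable D.poisson.derived D.poisson.derived :=
      fun d _ u _ => D.poisson.mem_derived d u
    refine hst.le_const_of_bracket_const D.centralConst hK fun u hu v hv => ?_
    rw [← proj_eq_zero_iff, ← lie_proj]
    have hu' := (D.proj_mem_derivedAlg_iff u).mpr hu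
    have hv' := (D.proj_mem_derivedAlg_iff v).mpr hv
    exact congrArg Subtype.val
      (hab.trivial (⟨D.proj u, hu'⟩ : D.derivedAlg) (⟨D.proj v, hv'⟩ : D.derivedAlg))

end

end TwistedHamiltonianData

theorem theorem1 {F Γ : Type*} [Field F] [CharZero F] [AddCommGroup Γ] [Nontrivial Γ]
    [IsAddTorsionFree Γ] {m : ℕ} (D : TwistedHamiltonianData F Γ m) :
    (D.multiIdx ≠ ⊥ → LieAlgebra.IsSimple F D.TwistedHamiltonian) ∧
    (D.multiIdx = ⊥ →
      LieAlgebra.IsSimple F D.derivedAlg ∧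
      IsCompl D.derivedAlg.toSubmodule D.sigmaLine) :=
  ⟨D.isSimple_of_multiIdx_ne_bot,
    fun hJ => ⟨D.isSimple_derivedAlg hJ, D.isCompl_derivedAlg_sigmaLine hJ⟩⟩
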